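/- Let $k$ be a field, $S=k[x_1,\dots,x_n]$, and let $M\subseteq S$ be a monomial ideal with minimal monomial generating set $G$. A set $D$ of monomials is called dominant if for each $m\in D$ there is a variable $x$ whose exponent in $m$ is strictly larger than its exponent in every other element of $D$. A monomial $x_1^{\alpha_1}\cdots x_n^{\alpha_n}$ strongly divides $x_1^{\beta_1}\cdots x_n^{\beta_n}$ if $\alpha_i<\beta_i$ whenever $\alpha_i\neq 0$. Let $\mathscr{D}_M$ be the class of all dominant sets $D\subseteq G$ of cardinality $n$ such that no element of $G$ strongly divides $\mathrm{lcm}(D)$, let $L=\{\mathrm{lcm}(D): D\in\mathscr{D}_M\}$, and for $j\ge 0$ let $L_j=\{l\in L:\deg l=j\}$. Consider multigraded free resolutions $\cdots\to F_1\to F_0\to S/M\to 0$ of $S/M$: the $F_i$ are free of finite rank with bases whose elements have monomials as multidegrees, and all maps preserve multidegrees. Such a resolution is minimal if no entry of the matrices of the maps $F_{i+1}\to F_i$, $i\ge 0$, is invertible. Then $S/M$ has a minimal multigraded free resolution. In every such resolution, the total Betti number $\beta_n(S/M)=\operatorname{rank}F_n$ satisfies $$\beta_n(S/M)=\#L,$$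 and, for every $j\ge 0$, the graded Betti number $\beta_{n,j}(S/M)$, that is, the number of basis elements of $F_n$ whose multidegree has total degree $j$, satisfies $$\beta_{n,j}(S/M)=\#L_j.$$ -/

import Mathlib

open MvPolynomial

namespace MonomialBetti

/-- Monomials of `k[x_1, …, x_n]` are represented by their exponent vectors. Divisibility of
monomials is the pointwise order `≤`, the lcm is the supremum `⊔`, and the degree of the monomial
is `Finsupp.degree`. -/
abbrev Mon (n : ℕ) : Type := Fin n →₀ ℕ

section Combinatorics

variable {n : ℕ}

/-- `m` is a dominant monomial in the set `L`: there is a variable `x` whose exponent in `m` is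
larger than its exponent in every other element of `L`. -/
def IsDominantIn (L : Set (Mon n)) (m : Mon n) : Prop :=
  ∃ x : Fin n, ∀ m' ∈ L, m' ≠ m → m' x < m x

/-- `L` is a dominant set: each of its elements is dominant in it. -/
def IsDominantSet (L : Set (Mon n)) : Prop :=
  ∀ m ∈ L, IsDominantIn L m

/-- `l` strongly divides `l'`. -/
def StronglyDivides (l l' : Mon n) : Prop :=
  ∀ i : Fin n, l i ≠ 0 → l i < l' i

/-- The least common multiple of a finite set of monomials. -/
noncomputable def lcm (D : Finset (Mon n)) : Mon n := D.sup id

end Combinatorics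

section Ideals

variable {n : ℕ} {k : Type*} [Field k]

/-- The ideal generated by a set of monomials. -/
noncomputable def monomialSpan (k : Type*) [Field k] (A : Set (Mon n)) : Ideal (MvPolynomial (Fin n) k) :=
  Ideal.span ((fun a => monomial a (1 : k)) '' A)

/-- `M` is a monomial ideal: it is generated by monomials. -/
def IsMonomialIdeal (M : Ideal (MvPolynomial (Fin n) k)) : Prop :=
  ∃ A : Set (Mon n), M = monomialSpan k A

/-- The minimal generating set `G` of a monomial ideal: the monomials of `M` that are minimal with
respect to divisibility. -/
def minGens (M : Ideal (MvPolynomial (Fin n) k)) : Set (Mon n) :=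
  {m | Minimal (fun a => monomial a (1 : k) ∈ M) m}

/-- `minGens M` generates the monomial ideal `M`. -/
theorem monomialSpan_minGens {M : Ideal (MvPolynomial (Fin n) k)} (hM : IsMonomialIdeal M) :
    monomialSpan k (minGens M) = M := by
  obtain ⟨A, hA⟩ := hM
  apply le_antisymm
  · refine Ideal.span_le.2 ?_
    rintro _ ⟨a, ha, rfl⟩
    exact ha.1
  · intro p hp
    rw [hA, monomialSpan, mem_ideal_span_monomial_image] at hp
    rw [monomialSpan, mem_ideal_span_monomial_image]
    intro e he
    obtain ⟨a, haA, hae⟩ := hp e he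
    have haM : monomial a (1 : k) ∈ M := by
      rw [hA]
      exact Ideal.subset_span ⟨a, haA, rfl⟩
    obtain ⟨b, hba, hb⟩ :=
      exists_minimal_le_of_wellFoundedLT (fun a => monomial a (1 : k) ∈ M) a haM
    exact ⟨b, hb, hba.trans hae⟩

/-- `minGens M` is contained in every set of monomials that generates `M`. -/
theorem minGens_subset {M : Ideal (MvPolynomial (Fin n) k)} {A : Set (Mon n)}
    (hA : M = monomialSpan k A) : minGens M ⊆ A := by
  intro m hm
  have h := hm.1
  simp only [hA, monomialSpan, mem_ideal_span_monomial_image] at h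
  obtain ⟨a, ha, ham⟩ := h m (by simp)
  have haM : monomial a (1 : k) ∈ M := by
    rw [hA]
    exact Ideal.subset_span ⟨a, ha, rfl⟩
  rwa [le_antisymm (hm.2 haM ham) ham]

/-- The class `𝒟_M` of all dominant subsets `D` of the minimal generating set `G` of `M`, of
cardinality the number `n` of variables, such that no element of `G` strongly divides `lcm D`. -/
def dominantClass (M : Ideal (MvPolynomial (Fin n) k)) : Set (Finset (Mon n)) :=
  {D | (D : Set (Mon n)) ⊆ minGens M ∧ IsDominantSet (D : Set (Mon n)) ∧ D.card = n ∧
    ∀ g ∈ minGens M, ¬ StronglyDivides g (lcm D)}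

/-- The set `L` of all monomials `lcm D` with `D ∈ 𝒟_M`. -/
def dominantLcms (M : Ideal (MvPolynomial (Fin n) k)) : Set (Mon n) :=
  {l | ∃ D ∈ dominantClass M, l = lcm D}

/-- A free resolution `⋯ → F_1 → F_0 → S/M → 0` by free `S`-modules of finite rank with bases that
are homogeneous with respect to the multigrading (the fine grading by monomials): `F_i` has the
standard basis indexed by `Fin (rank i)`, the `σ`-th basis element has multidegree `mdeg i σ`, and
all maps preserve multidegrees. -/
structure FreeResolution (M : Ideal (MvPolynomial (Fin n) k)) where
  /-- the rank of `F_i` -/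
  rank : ℕ → ℕ
  /-- the multidegrees of the basis elements of `F_i` -/
  mdeg : (i : ℕ) → Fin (rank i) → Mon n
  /-- the map `f_{i+1} : F_{i+1} → F_i` -/
  d : (i : ℕ) → (Fin (rank (i + 1)) → MvPolynomial (Fin n) k) →ₗ[MvPolynomial (Fin n) k]
    (Fin (rank i) → MvPolynomial (Fin n) k)
  /-- the map `f_0 : F_0 → S/M` -/
  aug : (Fin (rank 0) → MvPolynomial (Fin n) k) →ₗ[MvPolynomial (Fin n) k]
    (MvPolynomial (Fin n) k ⧸ M)
  aug_surjective : Function.Surjective aug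
  exact_zero : Function.Exact (d 0) aug
  exact_succ : ∀ i, Function.Exact (d (i + 1)) (d i)
  aug_homogeneous : ∀ σ, ∃ c : k,
    aug (Pi.single σ 1) = Ideal.Quotient.mk M (monomial (mdeg 0 σ) c)
  d_homogeneous : ∀ i σ τ, ∀ e ∈ (d i (Pi.single σ 1) τ).support,
    e + mdeg i τ = mdeg (i + 1) σ

namespace FreeResolution

variable {M : Ideal (MvPolynomial (Fin n) k)}

/-- A free resolution is minimal if no entry of its differential matrices is invertible. -/
def IsMinimal (F : FreeResolution M) : Prop :=
  ∀ i σ τ, ¬ IsUnit (F.d i (Pi.single σ 1) τ)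

/-- The number of basis elements of `F_i`; for a minimal resolution, the total Betti number
`β_i(S/M)`. -/
def totalBetti (F : FreeResolution M) (i : ℕ) : ℕ := F.rank i

/-- The number of basis elements of `F_i` of degree `j`, the degree being the total degree of the
multidegree; for a minimal resolution, the graded Betti number `β_{i,j}(S/M)`. -/
noncomputable def gradedBetti (F : FreeResolution M) (i j : ℕ) : ℕ :=
  Fintype.card {σ : Fin (F.rank i) // (F.mdeg i σ).degree = j}

end FreeResolution

end Ideals

end MonomialBetti

/-! For a minimal resolution `F`, the basis elements of `F_n` of multidegree `c` form a basis of the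
degree `c` part of Tor_n(S/M, k). By the Koszul complex this Tor is the socle of S/M shifted by
x_1⋯x_n: it has dimension one if c/(x_1⋯x_n) lies outside `M` but every variable multiplies it into
`M`, and is zero otherwise. So the multidegrees in `F_n` are distinct and are exactly these `c`, and
`dominantLcms_eq` identifies them with `L`.

No Tor functor or Koszul complex is built. Stripping monomials from the matrices of `F` leaves one
complex of based vector spaces, in which an order-convex set of multidegrees cuts out a subquotient.
The subquotient of `flag r c` is the degree `c` strand of F/(x_1,…,x_r)F: the strand of `F` for r =
0, and the basis elements of multidegree exactly `c` for r = n. Multiplication by the next variable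
gives short exact sequences relating length `r` to length `r + 1`.

`ResolvesUpTo` is the induction statement: homology vanishes above degree `r`, and in degree `r` it
is one-dimensional or zero as `IsPartialSocle` dictates. Its field `injective` says that
multiplication by the remaining variables is injective between nonzero degree `r` homologies. This
decides whether the kernel of the next variable is everything or zero. `resolvesUpTo_zero` starts
the induction, `ResolvesUpTo.succ` is the long exact sequence, and
`ResolvesUpTo.mdeg_injective_and_range` reads off the case r = n.

Existence comes from iterating covers by a least number of homogeneous generators. -/

namespace MonomialBetti

/-! ### Based complexes, their convex subquotients and the connecting map. -/

/-- A complex of finite-dimensional based vector spaces over `k`, whose basis elements carry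
multidegrees that the differential does not increase. -/
structure BasedComplex (n : ℕ) (k : Type*) [Field k] where
  /-- the number of basis elements -/
  rank : ℕ → ℕ
  /-- the multidegrees of the basis elements -/
  mdeg : (i : ℕ) → Fin (rank i) → Mon n
  /-- the differential -/
  d : (i : ℕ) → (Fin (rank (i + 1)) → k) →ₗ[k] (Fin (rank i) → k)
  d_le : ∀ i σ τ, d i (Pi.single σ 1) τ ≠ 0 → mdeg i τ ≤ mdeg (i + 1) σ
  d_d : ∀ i z, d i (d (i + 1) z) = 0

namespace BasedComplex

variable {n : ℕ} {k : Type*} [Field k] (K : BasedComplex n k)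

open Classical in
/-- The projection to the span of the basis elements with multidegree in `P`. -/
noncomputable def proj (P : Set (Mon n)) (i : ℕ) :
    (Fin (K.rank i) → k) →ₗ[k] (Fin (K.rank i) → k) where
  toFun z σ := if K.mdeg i σ ∈ P then z σ else 0
  map_add' x y := by ext σ; simp only [Pi.add_apply]; split_ifs <;> simp
  map_smul' a x := by ext σ; simp

/-- The differential of the subquotient spanned by the basis elements with multidegree in `P`. -/
noncomputable def dOn (P : Set (Mon n)) (i : ℕ) :
    (Fin (K.rank (i + 1)) → k) →ₗ[k] (Fin (K.rank i) → k) :=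
  K.proj P i ∘ₗ K.d i ∘ₗ K.proj P (i + 1)

/-- `z` is a cycle of the subquotient given by `P`. -/
def IsCycle (P : Set (Mon n)) : (i : ℕ) → (Fin (K.rank i) → k) → Prop
  | 0, z => K.proj P 0 z = z
  | i + 1, z => K.proj P (i + 1) z = z ∧ K.dOn P i z = 0

/-- `z` is a boundary of the subquotient given by `P`. -/
def IsBoundary (P : Set (Mon n)) (i : ℕ) (z : Fin (K.rank i) → k) : Prop :=
  ∃ w, z = K.dOn P i w

variable {K}

theorem proj_apply_of_mem {P : Set (Mon n)} {i : ℕ} {σ : Fin (K.rank i)} (h : K.mdeg i σ ∈ P)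
    (z : Fin (K.rank i) → k) : K.proj P i z σ = z σ := by
  simp [proj, h]

theorem proj_apply_of_notMem {P : Set (Mon n)} {i : ℕ} {σ : Fin (K.rank i)} (h : K.mdeg i σ ∉ P)
    (z : Fin (K.rank i) → k) : K.proj P i z σ = 0 := by
  simp [proj, h]

theorem proj_eq_self_iff {P : Set (Mon n)} {i : ℕ} {z : Fin (K.rank i) → k} :
    K.proj P i z = z ↔ ∀ σ, z σ ≠ 0 → K.mdeg i σ ∈ P := by
  constructor
  · intro h σ hσ
    by_contra hP
    exact hσ (by rw [← h, proj_apply_of_notMem hP])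
  · intro h
    ext σ
    by_cases hP : K.mdeg i σ ∈ P
    · rw [proj_apply_of_mem hP]
    · rw [proj_apply_of_notMem hP]
      by_contra h0
      exact hP (h σ (Ne.symm h0))

theorem proj_proj_of_subset {P Q : Set (Mon n)} (h : P ⊆ Q) {i : ℕ} (z : Fin (K.rank i) → k) :
    K.proj Q i (K.proj P i z) = K.proj P i z := by
  rw [proj_eq_self_iff]
  intro σ hσ
  by_contra hP
  exact hσ (proj_apply_of_notMem (fun h' => hP (h h')) z)

theorem proj_proj_of_subset' {P Q : Set (Mon n)} (h : P ⊆ Q) {i : ℕ} (z : Fin (K.rank i) → k) :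
    K.proj P i (K.proj Q i z) = K.proj P i z := by
  ext σ
  by_cases hP : K.mdeg i σ ∈ P
  · rw [proj_apply_of_mem hP, proj_apply_of_mem hP, proj_apply_of_mem (h hP)]
  · rw [proj_apply_of_notMem hP, proj_apply_of_notMem hP]

theorem proj_proj_of_disjoint {P Q : Set (Mon n)} (h : Disjoint P Q) {i : ℕ}
    (z : Fin (K.rank i) → k) : K.proj P i (K.proj Q i z) = 0 := by
  ext σ
  by_cases hP : K.mdeg i σ ∈ P
  · rw [proj_apply_of_mem hP, proj_apply_of_notMem (Set.disjoint_left.1 h hP)]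
    rfl
  · rw [proj_apply_of_notMem hP]
    rfl

theorem proj_union {A E : Set (Mon n)} (h : Disjoint A E) {i : ℕ} (z : Fin (K.rank i) → k) :
    K.proj (A ∪ E) i z = K.proj A i z + K.proj E i z := by
  ext σ
  rw [Pi.add_apply]
  by_cases hA : K.mdeg i σ ∈ A
  · rw [proj_apply_of_mem (Or.inl hA), proj_apply_of_mem hA,
      proj_apply_of_notMem (Set.disjoint_left.1 h hA), add_zero]
  · rw [proj_apply_of_notMem hA, zero_add]
    by_cases hE : K.mdeg i σ ∈ E
    · rw [proj_apply_of_mem (Or.inr hE), proj_apply_of_mem hE]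
    · rw [proj_apply_of_notMem hE, proj_apply_of_notMem]
      rintro (h' | h')
      exacts [hA h', hE h']

/-- The differential only meets basis elements of smaller multidegree. -/
theorem exists_le_of_d_ne_zero {i : ℕ} {z : Fin (K.rank (i + 1)) → k} {τ : Fin (K.rank i)}
    (h : K.d i z τ ≠ 0) : ∃ σ, z σ ≠ 0 ∧ K.mdeg i τ ≤ K.mdeg (i + 1) σ := by
  have hz : z = ∑ σ, z σ • Pi.single σ (1 : k) := by
    ext σ
    simp [Finset.sum_apply, Pi.single_apply]
  rw [hz, map_sum, Finset.sum_apply] at h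
  obtain ⟨σ, -, hσ⟩ := Finset.exists_ne_zero_of_sum_ne_zero h
  rw [map_smul, Pi.smul_apply, smul_eq_mul] at hσ
  exact ⟨σ, left_ne_zero_of_mul hσ, K.d_le i σ τ (right_ne_zero_of_mul hσ)⟩

theorem d_apply_eq_of_eq {i : ℕ} {z w : Fin (K.rank (i + 1)) → k} {τ : Fin (K.rank i)}
    (h : ∀ σ, K.mdeg i τ ≤ K.mdeg (i + 1) σ → z σ = w σ) : K.d i z τ = K.d i w τ := by
  by_contra hne
  have : K.d i (z - w) τ ≠ 0 := by
    rw [map_sub, Pi.sub_apply]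
    exact sub_ne_zero.2 hne
  obtain ⟨σ, hσ, hle⟩ := exists_le_of_d_ne_zero this
  exact hσ (by rw [Pi.sub_apply, h σ hle, sub_self])

theorem proj_dOn (P : Set (Mon n)) (i : ℕ) (z) : K.proj P i (K.dOn P i z) = K.dOn P i z :=
  proj_proj_of_subset subset_rfl _

theorem dOn_proj (P : Set (Mon n)) (i : ℕ) (z) : K.dOn P i (K.proj P (i + 1) z) = K.dOn P i z := by
  simp only [dOn, LinearMap.comp_apply, proj_proj_of_subset subset_rfl]

theorem dOn_apply_of_mem {P : Set (Mon n)} {i : ℕ} {τ : Fin (K.rank i)} (h : K.mdeg i τ ∈ P) (z) :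
    K.dOn P i z τ = K.d i (K.proj P (i + 1) z) τ :=
  proj_apply_of_mem h _

theorem dOn_apply_of_notMem {P : Set (Mon n)} {i : ℕ} {τ : Fin (K.rank i)} (h : K.mdeg i τ ∉ P)
    (z) : K.dOn P i z τ = 0 :=
  proj_apply_of_notMem h _

/-- Convexity is what makes truncation a complex: an intermediate basis element between two
multidegrees of `P` is itself in `P`, so no term of d∘d is lost. -/
theorem dOn_dOn {P : Set (Mon n)} (hP : P.OrdConnected) (i : ℕ) (z) :
    K.dOn P i (K.dOn P (i + 1) z) = 0 := by
  ext τ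
  by_cases hτ : K.mdeg i τ ∈ P
  · rw [dOn_apply_of_mem hτ, proj_dOn]
    have h0 := congrFun (K.d_d i (K.proj P _ z)) τ
    rw [← h0]
    refine d_apply_eq_of_eq fun σ hσ => ?_
    by_cases hσP : K.mdeg (i + 1) σ ∈ P
    · rw [dOn_apply_of_mem hσP]
    · rw [dOn_apply_of_notMem hσP]
      by_contra hne
      obtain ⟨ρ, hρ, hle⟩ := exists_le_of_d_ne_zero (Ne.symm hne)
      have hρP : K.mdeg (i + 1 + 1) ρ ∈ P := by
        by_contra h'
        exact hρ (proj_apply_of_notMem h' z)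
      exact hσP (hP.out hτ hρP ⟨hσ, hle⟩)
  · rw [dOn_apply_of_notMem hτ]
    rfl

section Union

variable {A E : Set (Mon n)} (hd : Disjoint A E) (hlow : ∀ a ∈ A, ∀ e ∈ E, ¬ e ≤ a)

include hlow

/-- Multidegrees never increase and no element of `E` lies below one of `A`, so `A` spans a
subcomplex. -/
theorem dOn_union_proj_lower (i : ℕ) (z) :
    K.dOn (A ∪ E) i (K.proj A (i + 1) z) = K.dOn A i z := by
  ext τ
  by_cases hA : K.mdeg i τ ∈ A
  · rw [dOn_apply_of_mem (Or.inl hA), dOn_apply_of_mem hA,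
      proj_proj_of_subset Set.subset_union_left]
  · rw [dOn_apply_of_notMem hA]
    by_cases hE : K.mdeg i τ ∈ E
    · rw [dOn_apply_of_mem (Or.inr hE), proj_proj_of_subset Set.subset_union_left]
      by_contra hne
      obtain ⟨σ, hσ, hle⟩ := exists_le_of_d_ne_zero hne
      have hσA : K.mdeg (i + 1) σ ∈ A := by
        by_contra h'
        exact hσ (proj_apply_of_notMem h' z)
      exact hlow _ hσA _ hE hle
    · rw [dOn_apply_of_notMem]
      rintro (h' | h')
      exacts [hA h', hE h']

include hd

theorem proj_upper_dOn_union (i : ℕ) (z) :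
    K.proj E i (K.dOn (A ∪ E) i z) = K.dOn E i z := by
  rw [← dOn_proj, proj_union hd, map_add, dOn_union_proj_lower hlow, map_add, ← proj_dOn A,
    proj_proj_of_disjoint hd.symm, zero_add]
  simp only [dOn, LinearMap.comp_apply]
  rw [proj_proj_of_subset' Set.subset_union_right, proj_proj_of_subset Set.subset_union_right]

/-- A cycle of the quotient is its own lift, so the connecting map is just the differential of the
union. -/
theorem dOn_union_of_cycle {i : ℕ} {z} (hz : K.dOn E i z = 0) :
    K.proj A i (K.dOn (A ∪ E) i z) = K.dOn (A ∪ E) i z := by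
  conv_rhs => rw [← proj_dOn, proj_union hd, proj_upper_dOn_union hd hlow, hz, add_zero]

/-- The connecting map sends cycles of the quotient to cycles of the subcomplex. -/
theorem isCycle_dOn_union (hB : (A ∪ E).OrdConnected) {i : ℕ} {z}
    (hz : K.IsCycle E (i + 1) z) : K.IsCycle A i (K.dOn (A ∪ E) i z) := by
  have h := dOn_union_of_cycle hd hlow hz.2
  cases i with
  | zero => exact h
  | succ i =>
    refine ⟨h, ?_⟩
    rw [← dOn_union_proj_lower hlow, h, dOn_dOn hB]

/-- The connecting map sends boundaries to boundaries. -/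
theorem isBoundary_dOn_union (hB : (A ∪ E).OrdConnected) {i : ℕ} {z}
    (hz : K.IsBoundary E (i + 1) z) : K.IsBoundary A i (K.dOn (A ∪ E) i z) := by
  obtain ⟨w, rfl⟩ := hz
  -- The full differential of `w` is its `A` part plus the given boundary. Applying the differential
  -- again gives zero, whence the sign.
  refine ⟨-K.dOn (A ∪ E) (i + 1) w, ?_⟩
  have h1 : K.dOn (A ∪ E) (i + 1) w
      = K.proj A _ (K.dOn (A ∪ E) (i + 1) w) + K.dOn E (i + 1) w := by
    conv_lhs => rw [← proj_dOn, proj_union hd, proj_upper_dOn_union hd hlow]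
  have h2 := congrArg (K.dOn (A ∪ E) i) h1
  rw [dOn_dOn hB, map_add, dOn_union_proj_lower hlow] at h2
  rw [map_neg]
  exact (neg_eq_of_add_eq_zero_right h2.symm).symm

/-- Injectivity of the connecting map. -/
theorem isBoundary_of_dOn_union {i : ℕ} {z} (hz : K.IsCycle E (i + 1) z)
    (hex : ∀ y, K.IsCycle (A ∪ E) (i + 1) y → K.IsBoundary (A ∪ E) (i + 1) y)
    (h : K.IsBoundary A i (K.dOn (A ∪ E) i z)) : K.IsBoundary E (i + 1) z := by
  obtain ⟨a, ha⟩ := h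
  obtain ⟨w, hw⟩ := hex (z - K.proj A _ a) ⟨by
    rw [map_sub, proj_proj_of_subset Set.subset_union_left]
    conv_lhs => rw [← hz.1, proj_proj_of_subset Set.subset_union_right, hz.1], by
    rw [map_sub, dOn_union_proj_lower hlow, ha, sub_self]⟩
  refine ⟨w, ?_⟩
  rw [← proj_upper_dOn_union hd hlow, ← hw, map_sub, proj_proj_of_disjoint hd.symm, hz.1, sub_zero]

/-- Cycles of the subcomplex that bound in the complex are hit by the connecting map. -/
theorem exists_isCycle_of_isBoundary_union {i : ℕ} {y} (hy : K.proj A i y = y)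
    (h : K.IsBoundary (A ∪ E) i y) :
    ∃ z, K.IsCycle E (i + 1) z ∧ K.IsBoundary A i (y - K.dOn (A ∪ E) i z) := by
  obtain ⟨w, hw⟩ := h
  refine ⟨K.proj E _ w, ⟨proj_proj_of_subset subset_rfl _, ?_⟩, w, ?_⟩
  · rw [dOn_proj, ← proj_upper_dOn_union hd hlow, ← hw, ← hy, proj_proj_of_disjoint hd.symm]
  · rw [hw, ← dOn_proj, proj_union hd, map_add, dOn_union_proj_lower hlow, add_sub_cancel_right]

end Union

theorem IsCycle.proj_eq {P : Set (Mon n)} {i : ℕ} {z} (h : K.IsCycle P i z) : K.proj P i z = z := by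
  cases i with
  | zero => exact h
  | succ i => exact h.1

theorem IsCycle.sub_smul {P : Set (Mon n)} {i : ℕ} {z w} (h : K.IsCycle P i z)
    (h' : K.IsCycle P i w) (a : k) : K.IsCycle P i (z - a • w) := by
  cases i with
  | zero =>
    have h1 : K.proj P 0 z = z := h
    have h2 : K.proj P 0 w = w := h'
    change K.proj P 0 _ = _
    rw [map_sub, map_smul, h1, h2]
  | succ i => exact ⟨by rw [map_sub, map_smul, h.1, h'.1], by rw [map_sub, map_smul, h.2, h'.2]; simp⟩

theorem IsBoundary.add {P : Set (Mon n)} {i : ℕ} {z w} (h : K.IsBoundary P i z)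
    (h' : K.IsBoundary P i w) : K.IsBoundary P i (z + w) := by
  obtain ⟨x, rfl⟩ := h
  obtain ⟨y, rfl⟩ := h'
  exact ⟨x + y, (map_add _ _ _).symm⟩

theorem IsBoundary.smul {P : Set (Mon n)} {i : ℕ} {z} (h : K.IsBoundary P i z) (a : k) :
    K.IsBoundary P i (a • z) := by
  obtain ⟨x, rfl⟩ := h
  exact ⟨a • x, (map_smul _ _ _).symm⟩

end BasedComplex

/-! ### Flags of multidegrees and partial socles. -/

/-- The monomials dividing `c` that have the same exponents as `c` in the first `r` variables. -/
def flag {n : ℕ} (r : ℕ) (c : Mon n) : Set (Mon n) :=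
  {b | b ≤ c ∧ ∀ j : Fin n, j.1 < r → b j = c j}

/-- The product of the first `r` variables. -/
noncomputable def firstVars (n r : ℕ) : Mon n :=
  Finsupp.equivFunOnFinite.symm fun j => if j.1 < r then 1 else 0

/-- The monomial `c` divided by the first `r` variables is a monomial outside `I` that the first
`r` variables multiply into `I`. -/
def IsPartialSocle {n : ℕ} (I : Set (Mon n)) (r : ℕ) (c : Mon n) : Prop :=
  firstVars n r ≤ c ∧ c - firstVars n r ∉ I ∧
    ∀ j : Fin n, j.1 < r → c - firstVars n r + Finsupp.single j 1 ∈ I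

section Flag

variable {n : ℕ}

theorem firstVars_apply (r : ℕ) (j : Fin n) : firstVars n r j = if j.1 < r then 1 else 0 := rfl

theorem firstVars_succ {r : ℕ} (hr : r < n) :
    firstVars n (r + 1) = firstVars n r + Finsupp.single ⟨r, hr⟩ 1 := by
  ext j
  rw [Finsupp.add_apply, firstVars_apply, firstVars_apply, Finsupp.single_apply]
  simp only [Fin.ext_iff]
  split_ifs <;> omega

theorem ordConnected_flag (r : ℕ) (c : Mon n) : (flag r c).OrdConnected := by
  refine ⟨fun a ha b hb x hx => ⟨hx.2.trans hb.1, fun j hj => le_antisymm ?_ ?_⟩⟩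
  · rw [← hb.2 j hj]; exact hx.2 j
  · rw [← ha.2 j hj]; exact hx.1 j

theorem flag_zero (c : Mon n) : flag 0 c = Set.Iic c := by
  ext b; simp [flag]

theorem flag_self (c : Mon n) : flag n c = {c} := by
  ext b
  constructor
  · exact fun h => Finsupp.ext fun j => h.2 j j.2
  · rintro rfl
    exact ⟨le_rfl, fun _ _ => rfl⟩

/-- The two pieces are the multidegrees with exponent below, respectively equal to, that of `c` in
the next variable: the image of multiplication by that variable, and its cokernel. -/
theorem flag_eq_union {r : ℕ} (hr : r < n) {c : Mon n} (hc : Finsupp.single ⟨r, hr⟩ 1 ≤ c) :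
    flag r c = flag r (c - Finsupp.single ⟨r, hr⟩ 1) ∪ flag (r + 1) c := by
  have hc' : 1 ≤ c ⟨r, hr⟩ := by simpa using hc ⟨r, hr⟩
  ext b
  constructor
  · rintro ⟨h1, h2⟩
    by_cases h : b ⟨r, hr⟩ = c ⟨r, hr⟩
    · refine Or.inr ⟨h1, fun j hj => ?_⟩
      rcases Nat.lt_succ_iff_lt_or_eq.1 hj with h' | h'
      · exact h2 j h'
      · have : j = ⟨r, hr⟩ := Fin.ext h'
        rw [this, h]
    · refine Or.inl ⟨fun j => ?_, fun j hj => ?_⟩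
      · rw [Finsupp.tsub_apply, Finsupp.single_apply]
        have := h1 j
        split_ifs with hj
        · subst hj; omega
        · simpa using this
      · rw [Finsupp.tsub_apply, Finsupp.single_apply, if_neg, h2 j hj]
        · simp
        · intro h'; rw [← h'] at hj; exact lt_irrefl _ hj
  · rintro (⟨h1, h2⟩ | ⟨h1, h2⟩)
    · refine ⟨h1.trans tsub_le_self, fun j hj => ?_⟩
      rw [h2 j hj, Finsupp.tsub_apply, Finsupp.single_apply, if_neg]
      · simp
      · intro h'; rw [← h'] at hj; exact lt_irrefl _ hj
    · exact ⟨h1, fun j hj => h2 j (hj.trans (Nat.lt_succ_self r))⟩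

theorem not_le_of_mem_flag {r : ℕ} (hr : r < n) {c : Mon n} (hc : Finsupp.single ⟨r, hr⟩ 1 ≤ c)
    {a e : Mon n} (ha : a ∈ flag r (c - Finsupp.single ⟨r, hr⟩ 1)) (he : e ∈ flag (r + 1) c) :
    ¬ e ≤ a := by
  intro h
  have hc' : 1 ≤ c ⟨r, hr⟩ := by simpa using hc ⟨r, hr⟩
  have h1 := ha.1 ⟨r, hr⟩
  rw [Finsupp.tsub_apply, Finsupp.single_apply, if_pos rfl] at h1
  have h2 := he.2 ⟨r, hr⟩ (Nat.lt_succ_self r)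
  have h3 := h ⟨r, hr⟩
  omega

theorem flag_succ_of_not_le {r : ℕ} (hr : r < n) {c : Mon n}
    (hc : ¬ Finsupp.single ⟨r, hr⟩ 1 ≤ c) : flag (r + 1) c = flag r c := by
  have hc' : c ⟨r, hr⟩ = 0 := by
    by_contra h
    exact hc (by rw [Finsupp.single_le_iff]; omega)
  ext b
  refine ⟨fun h => ⟨h.1, fun j hj => h.2 j (hj.trans (Nat.lt_succ_self r))⟩, fun h => ⟨h.1, fun j hj => ?_⟩⟩
  rcases Nat.lt_succ_iff_lt_or_eq.1 hj with h' | h'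
  · exact h.2 j h'
  · have hj' : j = ⟨r, hr⟩ := Fin.ext h'
    have := h.1 j
    rw [hj'] at this ⊢
    omega

/-- The next partial socle is the kernel of the next variable on the present one: degree c/x_{r+1}
survives, but its image in degree `c` does not. -/
theorem isPartialSocle_succ_iff {I : Set (Mon n)} (hI : IsUpperSet I) {r : ℕ} (hr : r < n)
    {c : Mon n} : IsPartialSocle I (r + 1) c ↔ Finsupp.single ⟨r, hr⟩ 1 ≤ c ∧
      IsPartialSocle I r (c - Finsupp.single ⟨r, hr⟩ 1) ∧ ¬ IsPartialSocle I r c := by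
  have hv : firstVars n r ⟨r, hr⟩ = 0 := by simp [firstVars_apply]
  have hle : firstVars n (r + 1) ≤ c ↔ Finsupp.single ⟨r, hr⟩ 1 ≤ c ∧ firstVars n r ≤ c := by
    rw [firstVars_succ hr]
    refine ⟨fun h => ⟨le_add_self.trans h, le_self_add.trans h⟩, fun h j => ?_⟩
    rw [Finsupp.add_apply]
    by_cases hj : j = ⟨r, hr⟩
    · subst hj; rw [hv, zero_add]; exact h.1 _
    · rw [Finsupp.single_apply, if_neg (Ne.symm hj), add_zero]; exact h.2 j
  have hle' : firstVars n r ≤ c - Finsupp.single ⟨r, hr⟩ 1 ↔ firstVars n r ≤ c := by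
    refine ⟨fun h => h.trans tsub_le_self, fun h j => ?_⟩
    rw [Finsupp.tsub_apply]
    by_cases hj : j = ⟨r, hr⟩
    · subst hj; rw [hv]; exact Nat.zero_le _
    · rw [Finsupp.single_apply, if_neg (Ne.symm hj)]; exact h j
  have hsub : c - firstVars n (r + 1) = c - Finsupp.single ⟨r, hr⟩ 1 - firstVars n r := by
    rw [firstVars_succ hr, tsub_tsub, add_comm]
  unfold IsPartialSocle
  rw [hle, hle', hsub]
  by_cases h1 : Finsupp.single ⟨r, hr⟩ 1 ≤ c
  swap
  · simp [h1]
  by_cases h2 : firstVars n r ≤ c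
  swap
  · simp [h2]
  have hadd : c - Finsupp.single ⟨r, hr⟩ 1 - firstVars n r + Finsupp.single ⟨r, hr⟩ 1
      = c - firstVars n r := by
    rw [tsub_right_comm, tsub_add_cancel_of_le]
    intro j
    rw [Finsupp.tsub_apply]
    by_cases hj : j = ⟨r, hr⟩
    · subst hj; rw [hv]; exact h1 _
    · rw [Finsupp.single_apply, if_neg (Ne.symm hj)]; exact Nat.zero_le _
  have hmono : ∀ j : Fin n, c - Finsupp.single ⟨r, hr⟩ 1 - firstVars n r + Finsupp.single j 1
      ≤ c - firstVars n r + Finsupp.single j 1 := fun j =>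
    add_le_add_left (tsub_le_tsub_right tsub_le_self _) _
  constructor
  · rintro ⟨-, h3, h4⟩
    refine ⟨h1, ⟨h2, h3, fun j hj => h4 j (hj.trans (Nat.lt_succ_self r))⟩, fun h => h.2.1 ?_⟩
    rw [← hadd]
    exact h4 _ (Nat.lt_succ_self r)
  · rintro ⟨-, ⟨-, h3, h4⟩, h5⟩
    refine ⟨⟨h1, h2⟩, h3, fun j hj => ?_⟩
    rcases Nat.lt_succ_iff_lt_or_eq.1 hj with h' | h'
    · exact h4 j h'
    · have hj' : j = ⟨r, hr⟩ := Fin.ext h'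
      rw [hj', hadd]
      by_contra h6
      -- If c/(x_1⋯x_r) were outside `I`, upward closure of `I` would make `c` a partial socle
      -- degree of length `r`.
      exact h5 ⟨h2, h6, fun j hj => hI (hmono j) (h4 j hj)⟩

end Flag

/-! ### Induction on the number of variables factored out. -/

namespace BasedComplex

variable {n : ℕ} {k : Type*} [Field k] (K : BasedComplex n k)

/-- The homology of the subquotients of `K` given by the flags of length `r` is that of the partial
Koszul complexes of the quotient by the monomial ideal with exponent set `I`, as far as it lies in
the top degree `r` or higher. -/
structure ResolvesUpTo (I : Set (Mon n)) (r : ℕ) : Prop where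
  exact : ∀ c i z, r < i → K.IsCycle (flag r c) i z → K.IsBoundary (flag r c) i z
  exact_of_not : ∀ c z, ¬ IsPartialSocle I r c → K.IsCycle (flag r c) r z →
    K.IsBoundary (flag r c) r z
  exists_generator : ∀ c, IsPartialSocle I r c → ∃ y, K.IsCycle (flag r c) r y ∧
    ¬ K.IsBoundary (flag r c) r y ∧
    ∀ z, K.IsCycle (flag r c) r z → ∃ a : k, K.IsBoundary (flag r c) r (z - a • y)
  injective : ∀ c c', c ≤ c' → (∀ j : Fin n, j.1 < r → c j = c' j) → IsPartialSocle I r c →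
    IsPartialSocle I r c' → ∀ z, K.IsCycle (flag r c) r z → K.IsBoundary (flag r c') r z →
    K.IsBoundary (flag r c) r z

variable {K}

/-- Enlarging `c` only in the later variables includes one strand as a subcomplex of another. This
makes the connecting maps for `c` and `c'` compatible. -/
theorem dOn_flag_eq_of_le {r i : ℕ} {c c' : Mon n} (hle : c ≤ c')
    (heq : ∀ j : Fin n, j.1 < r → c j = c' j) {z} (hz : K.proj (flag r c) (i + 1) z = z) :
    K.dOn (flag r c') i z = K.dOn (flag r c) i z := by
  have hsub : flag r c ⊆ flag r c' := fun b hb =>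
    ⟨hb.1.trans hle, fun j hj => (hb.2 j hj).trans (heq j hj)⟩
  ext τ
  have hz' : K.proj (flag r c') (i + 1) z = z := by
    conv_lhs => rw [← hz, proj_proj_of_subset hsub, hz]
  by_cases hτ : K.mdeg i τ ∈ flag r c
  · rw [dOn_apply_of_mem hτ, dOn_apply_of_mem (hsub hτ), hz, hz']
  · rw [dOn_apply_of_notMem hτ]
    by_cases hτ' : K.mdeg i τ ∈ flag r c'
    · rw [dOn_apply_of_mem hτ', hz']
      by_contra hne
      obtain ⟨σ, hσ, hσle⟩ := exists_le_of_d_ne_zero hne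
      have hσm := proj_eq_self_iff.1 hz σ hσ
      exact hτ ⟨hσle.trans hσm.1, fun j hj => (hτ'.2 j hj).trans (heq j hj).symm⟩
    · rw [dOn_apply_of_notMem hτ']

theorem ResolvesUpTo.succ {I : Set (Mon n)} (hI : IsUpperSet I) {r : ℕ} (hr : r < n)
    (h : K.ResolvesUpTo I r) : K.ResolvesUpTo I (r + 1) := by
  have hunion : ∀ {c : Mon n}, Finsupp.single ⟨r, hr⟩ 1 ≤ c →
      flag r c = flag r (c - Finsupp.single ⟨r, hr⟩ 1) ∪ flag (r + 1) c := flag_eq_union hr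
  have hlow : ∀ {c : Mon n}, Finsupp.single ⟨r, hr⟩ 1 ≤ c →
      ∀ a ∈ flag r (c - Finsupp.single ⟨r, hr⟩ 1), ∀ e ∈ flag (r + 1) c, ¬ e ≤ a :=
    fun hc a ha e he => not_le_of_mem_flag hr hc ha he
  have hdis : ∀ {c : Mon n}, Finsupp.single ⟨r, hr⟩ 1 ≤ c →
      Disjoint (flag r (c - Finsupp.single ⟨r, hr⟩ 1)) (flag (r + 1) c) := fun hc =>
    Set.disjoint_left.2 fun a ha he => hlow hc a ha a he le_rfl
  have hord : ∀ {c : Mon n}, Finsupp.single ⟨r, hr⟩ 1 ≤ c →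
      (flag r (c - Finsupp.single ⟨r, hr⟩ 1) ∪ flag (r + 1) c).OrdConnected := fun hc => by
    rw [← hunion hc]; exact ordConnected_flag r _
  have hcyc : ∀ {c : Mon n}, Finsupp.single ⟨r, hr⟩ 1 ≤ c → ∀ {i z},
      K.IsCycle (flag (r + 1) c) (i + 1) z →
      K.IsCycle (flag r (c - Finsupp.single ⟨r, hr⟩ 1)) i (K.dOn (flag r c) i z) := by
    intro c hc i z hz
    rw [hunion hc]
    exact isCycle_dOn_union (hdis hc) (hlow hc) (hord hc) hz
  have hbdry : ∀ {c : Mon n}, Finsupp.single ⟨r, hr⟩ 1 ≤ c → ∀ {i z},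
      K.IsBoundary (flag (r + 1) c) (i + 1) z →
      K.IsBoundary (flag r (c - Finsupp.single ⟨r, hr⟩ 1)) i (K.dOn (flag r c) i z) := by
    intro c hc i z hz
    rw [hunion hc]
    exact isBoundary_dOn_union (hdis hc) (hlow hc) (hord hc) hz
  -- The connecting map is injective on homology from degree `r + 1` on, because the middle strand
  -- is exact above degree `r`.
  have hinj : ∀ {c : Mon n}, Finsupp.single ⟨r, hr⟩ 1 ≤ c → ∀ {i z}, r ≤ i →
      K.IsCycle (flag (r + 1) c) (i + 1) z →
      K.IsBoundary (flag r (c - Finsupp.single ⟨r, hr⟩ 1)) i (K.dOn (flag r c) i z) →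
      K.IsBoundary (flag (r + 1) c) (i + 1) z := by
    intro c hc i z hi hz hb
    rw [hunion hc] at hb
    refine isBoundary_of_dOn_union (hdis hc) (hlow hc) hz (fun y hy => ?_) hb
    rw [← hunion hc] at hy ⊢
    exact h.exact c (i + 1) y (Nat.lt_succ_of_le hi) hy
  refine ⟨?_, ?_, ?_, ?_⟩
  · intro c i z hi hz
    by_cases hc : Finsupp.single ⟨r, hr⟩ 1 ≤ c
    · obtain ⟨i, rfl⟩ : ∃ i', i = i' + 1 := ⟨i - 1, by omega⟩
      exact hinj hc (by omega) hz (h.exact _ _ _ (by omega) (hcyc hc hz))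
    · rw [flag_succ_of_not_le hr hc] at hz ⊢
      exact h.exact c i z (by omega) hz
  · intro c z hs hz
    by_cases hc : Finsupp.single ⟨r, hr⟩ 1 ≤ c
    · refine hinj hc le_rfl hz ?_
      by_cases hs' : IsPartialSocle I r (c - Finsupp.single ⟨r, hr⟩ 1)
      · have hs'' : IsPartialSocle I r c := by
          by_contra h'
          exact hs ((isPartialSocle_succ_iff hI hr).2 ⟨hc, hs', h'⟩)
        -- Both ends are now nonzero, so multiplication by the variable is injective. The image of
        -- `z` bounds in the middle strand, by `z` itself.
        refine h.injective _ c tsub_le_self (fun j hj => ?_) hs' hs'' _ (hcyc hc hz) ⟨z, rfl⟩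
        rw [Finsupp.tsub_apply, Finsupp.single_apply, if_neg]
        · simp
        · intro h'; rw [← h'] at hj; exact lt_irrefl _ hj
      · exact h.exact_of_not _ _ hs' (hcyc hc hz)
    · rw [flag_succ_of_not_le hr hc] at hz ⊢
      exact h.exact c (r + 1) z (Nat.lt_succ_self r) hz
  · intro c hs
    obtain ⟨hc, hs', hs''⟩ := (isPartialSocle_succ_iff hI hr).1 hs
    obtain ⟨y, hy, hyb, hgen⟩ := h.exists_generator _ hs'
    have hyB : K.IsCycle (flag r c) r y := by
      have hsub : flag r (c - Finsupp.single ⟨r, hr⟩ 1) ⊆ flag r c := by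
        rw [hunion hc]; exact Set.subset_union_left
      have hp : K.proj (flag r c) r y = y := by
        conv_lhs => rw [← hy.proj_eq, proj_proj_of_subset hsub, hy.proj_eq]
      clear hgen hyb
      cases r with
      | zero => exact hp
      | succ r =>
        refine ⟨hp, ?_⟩
        rw [← hy.1, hunion hc, dOn_union_proj_lower (hlow hc), hy.2]
    -- The generator in degree c/x_{r+1} dies in degree `c`, hence is hit by the connecting map. Its
    -- preimage `x` is the new generator.
    have hyb' := h.exact_of_not c y hs'' hyB
    rw [hunion hc] at hyb'
    obtain ⟨x, hx, hxy⟩ :=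
      exists_isCycle_of_isBoundary_union (hdis hc) (hlow hc) hy.proj_eq hyb'
    rw [← hunion hc] at hxy
    refine ⟨x, hx, fun hxb => hyb ?_, fun z hz => ?_⟩
    · simpa using hxy.add (hbdry hc hxb)
    · obtain ⟨a, ha⟩ := hgen _ (hcyc hc hz)
      refine ⟨a, hinj hc le_rfl (hz.sub_smul hx a) ?_⟩
      have := ha.add (hxy.smul a)
      convert this using 1
      rw [map_sub, map_smul, smul_sub]
      abel
  · intro c c' hle heq hs hs' z hz hb
    obtain ⟨hc, hs1, -⟩ := (isPartialSocle_succ_iff hI hr).1 hs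
    obtain ⟨hc', hs1', -⟩ := (isPartialSocle_succ_iff hI hr).1 hs'
    have hle' : c - Finsupp.single ⟨r, hr⟩ 1 ≤ c' - Finsupp.single ⟨r, hr⟩ 1 := fun j => by
      rw [Finsupp.tsub_apply, Finsupp.tsub_apply]
      exact Nat.sub_le_sub_right (hle j) _
    refine hinj hc le_rfl hz (h.injective _ (c' - Finsupp.single ⟨r, hr⟩ 1) hle' (fun j hj => ?_) hs1 hs1' _ (hcyc hc hz) ?_)
    · rw [Finsupp.tsub_apply, Finsupp.tsub_apply, heq j (hj.trans (Nat.lt_succ_self r))]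
    · have hzB : K.proj (flag r c) (r + 1) z = z := by
        have hsub : flag (r + 1) c ⊆ flag r c := by
          rw [hunion hc]
          exact Set.subset_union_right
        exact proj_eq_self_iff.2 fun σ hσ => hsub (proj_eq_self_iff.1 hz.1 σ hσ)
      rw [← dOn_flag_eq_of_le hle (fun j hj => heq j (hj.trans (Nat.lt_succ_self r))) hzB]
      exact hbdry hc' hb

theorem ResolvesUpTo.of_zero {I : Set (Mon n)} (hI : IsUpperSet I) (h : K.ResolvesUpTo I 0) {r : ℕ}
    (hr : r ≤ n) : K.ResolvesUpTo I r := by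
  induction r with
  | zero => exact h
  | succ r ih => exact (ih (Nat.le_of_succ_le hr)).succ hI hr

/-- If the differential vanishes between basis elements of the same multidegree, then the
multidegrees of the `n`-th basis are distinct and are those of the socle. -/
theorem ResolvesUpTo.mdeg_injective_and_range {I : Set (Mon n)} (h : K.ResolvesUpTo I n)
    (hmin : ∀ i σ τ, K.mdeg i τ = K.mdeg (i + 1) σ → K.d i (Pi.single σ 1) τ = 0) :
    Function.Injective (K.mdeg n) ∧ Set.range (K.mdeg n) = {c | IsPartialSocle I n c} := by
  -- A flag of full length is the single multidegree `c`, where minimality kills the differential: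
  -- all chains are cycles and only zero bounds.
  have hd : ∀ (c : Mon n) i z, K.dOn (flag n c) i z = 0 := by
    intro c i z
    rw [flag_self]
    ext τ
    by_cases hτ : K.mdeg i τ = c
    · rw [dOn_apply_of_mem hτ]
      have hz : K.proj {c} (i + 1) z = ∑ σ, K.proj {c} (i + 1) z σ • Pi.single σ (1 : k) := by
        ext σ
        simp [Finset.sum_apply, Pi.single_apply]
      rw [hz, map_sum, Finset.sum_apply]
      refine Finset.sum_eq_zero fun σ _ => ?_
      rw [map_smul, Pi.smul_apply, smul_eq_mul]
      by_cases hσ : K.mdeg (i + 1) σ = c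
      · rw [hmin i σ τ (hτ.trans hσ.symm), mul_zero]
      · rw [proj_apply_of_notMem hσ, zero_mul]
    · rw [dOn_apply_of_notMem hτ]
      rfl
  have hcyc : ∀ i σ, K.IsCycle (flag n (K.mdeg i σ)) i (Pi.single σ 1) := by
    intro i σ
    have hp : K.proj (flag n (K.mdeg i σ)) i (Pi.single σ 1) = Pi.single σ 1 := by
      rw [proj_eq_self_iff]
      intro τ hτ
      have : τ = σ := by
        by_contra hne
        exact hτ (Pi.single_eq_of_ne hne _)
      rw [this, flag_self]
      rfl
    cases i with
    | zero => exact hp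
    | succ i => exact ⟨hp, hd _ _ _⟩
  have hb : ∀ {c : Mon n} {i z}, K.IsBoundary (flag n c) i z → z = 0 := by
    rintro c i z ⟨w, rfl⟩
    exact hd _ _ _
  have hne : ∀ i σ, (Pi.single σ 1 : Fin (K.rank i) → k) ≠ 0 := fun i σ h0 => by
    simpa using congrFun h0 σ
  have hsoc : ∀ σ, IsPartialSocle I n (K.mdeg n σ) := by
    intro σ
    by_contra hs
    exact hne n σ (hb (h.exact_of_not _ _ hs (hcyc n σ)))
  refine ⟨fun σ τ hστ => ?_, Set.Subset.antisymm ?_ fun c hc => ?_⟩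
  -- Two basis vectors of equal multidegree would both be multiples of the same `y`.
  · obtain ⟨y, -, -, hgen⟩ := h.exists_generator _ (hsoc σ)
    obtain ⟨a, ha⟩ := hgen _ (hcyc n σ)
    obtain ⟨b, hb'⟩ := hgen _ (by rw [hστ]; exact hcyc n τ)
    have ha := sub_eq_zero.1 (hb ha)
    have hb' := sub_eq_zero.1 (hb hb')
    by_contra hne'
    have h1 := congrFun ha σ
    have h2 := congrFun ha τ
    have h3 := congrFun hb' τ
    rw [Pi.single_eq_same, Pi.smul_apply, smul_eq_mul] at h1 h3
    rw [Pi.single_eq_of_ne (Ne.symm hne'), Pi.smul_apply, smul_eq_mul] at h2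
    rcases mul_eq_zero.1 h2.symm with h0 | h0
    · rw [h0, zero_mul] at h1; exact one_ne_zero h1
    · rw [h0, mul_zero] at h3; exact one_ne_zero h3
  · rintro _ ⟨σ, rfl⟩
    exact hsoc σ
  · obtain ⟨y, hy, hyb, -⟩ := h.exists_generator c hc
    have hy0 : y ≠ 0 := by
      rintro rfl
      exact hyb ⟨0, (map_zero _).symm⟩
    obtain ⟨σ, hσ⟩ := Function.ne_iff.1 hy0
    have := proj_eq_self_iff.1 hy.proj_eq σ hσ
    rw [flag_self] at this
    exact ⟨σ, this⟩

end BasedComplex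

end MonomialBetti
-- Homogeneous components and scalar matrices of graded maps.
namespace MonomialBetti

section Components

variable {n : ℕ} {k : Type*} [Field k] {r r' : ℕ}

/-- The coefficients of the component of multidegree `c` of an element of the free module with
basis elements of multidegrees `m`. -/
noncomputable def component (m : Fin r → Mon n) (c : Mon n) :
    (Fin r → MvPolynomial (Fin n) k) →ₗ[k] (Fin r → k) where
  toFun p σ := coeff c (monomial (m σ) 1 * p σ)
  map_add' p q := by ext σ; simp [mul_add]
  map_smul' a p := by ext σ; simp

/-- The homogeneous element of multidegree `c` with coefficients `z`. -/
noncomputable def homogeneousElement (m : Fin r → Mon n) (c : Mon n) (z : Fin r → k) :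
    Fin r → MvPolynomial (Fin n) k := fun σ => monomial (c - m σ) (if m σ ≤ c then z σ else 0)

theorem component_apply (m : Fin r → Mon n) (c : Mon n) (p : Fin r → MvPolynomial (Fin n) k)
    (σ : Fin r) : component m c p σ = coeff c (monomial (m σ) 1 * p σ) := rfl

theorem component_apply_of_not_le {m : Fin r → Mon n} {c : Mon n} {σ : Fin r} (h : ¬ m σ ≤ c)
    (p : Fin r → MvPolynomial (Fin n) k) : component m c p σ = 0 := by
  rw [component_apply, coeff_monomial_mul', if_neg h]

theorem ext_component {m : Fin r → Mon n} {p q : Fin r → MvPolynomial (Fin n) k}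
    (h : ∀ c, component m c p = component m c q) : p = q := by
  ext σ c
  have := congrFun (h (m σ + c)) σ
  rwa [component_apply, component_apply, coeff_monomial_mul, coeff_monomial_mul, one_mul,
    one_mul] at this

theorem component_homogeneousElement (m : Fin r → Mon n) (c c' : Mon n) (z : Fin r → k)
    (σ : Fin r) : component m c' (homogeneousElement m c z) σ =
      if c = c' ∧ m σ ≤ c then z σ else 0 := by
  rw [component_apply, homogeneousElement]
  by_cases h : m σ ≤ c
  · rw [monomial_mul, one_mul, coeff_monomial, add_tsub_cancel_of_le h, if_pos h]
    simp [h]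
  · simp [h]

theorem component_homogeneousElement_self {m : Fin r → Mon n} {c : Mon n} {z : Fin r → k}
    (hz : ∀ σ, z σ ≠ 0 → m σ ≤ c) : component m c (homogeneousElement m c z) = z := by
  ext σ
  rw [component_homogeneousElement]
  by_cases h : z σ = 0
  · simp [h]
  · simp [hz σ h]

theorem component_homogeneousElement_of_ne {m : Fin r → Mon n} {c c' : Mon n} (h : c ≠ c')
    (z : Fin r → k) : component m c' (homogeneousElement m c z) = 0 := by
  ext σ
  rw [component_homogeneousElement]
  simp [h]

/-- The sum of the homogeneous components of `p` is `p`. -/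
theorem exists_sum_homogeneousElement (m : Fin r → Mon n) (p : Fin r → MvPolynomial (Fin n) k) :
    ∃ T : Finset (Mon n), p = ∑ c ∈ T, homogeneousElement m c (component m c p) := by
  classical
  refine ⟨Finset.univ.biUnion fun σ => (monomial (m σ) (1 : k) * p σ).support,
    ext_component (m := m) fun c => ?_⟩
  rw [map_sum]
  have hself : component m c (homogeneousElement m c (component m c p)) = component m c p :=
    component_homogeneousElement_self fun σ hσ => by
      by_contra h
      exact hσ (component_apply_of_not_le h p)
  rw [Finset.sum_eq_single c (fun c' _ hne => component_homogeneousElement_of_ne hne _), hself]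
  intro hc
  rw [hself]
  ext σ
  by_contra hne
  refine hc (Finset.mem_biUnion.2 ⟨σ, Finset.mem_univ _, ?_⟩)
  rwa [mem_support_iff]

/-- A map of free modules that preserves multidegrees. -/
def IsHomogeneousMap (m' : Fin r' → Mon n) (m : Fin r → Mon n)
    (g : (Fin r' → MvPolynomial (Fin n) k) →ₗ[MvPolynomial (Fin n) k]
      (Fin r → MvPolynomial (Fin n) k)) : Prop :=
  ∀ σ τ, ∀ e ∈ (g (Pi.single σ 1) τ).support, e + m τ = m' σ

/-- The matrix of scalars of a map that preserves multidegrees, as a linear map. -/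
noncomputable def scalarMap (m' : Fin r' → Mon n) (m : Fin r → Mon n)
    (g : (Fin r' → MvPolynomial (Fin n) k) →ₗ[MvPolynomial (Fin n) k]
      (Fin r → MvPolynomial (Fin n) k)) : (Fin r' → k) →ₗ[k] (Fin r → k) where
  toFun z τ := ∑ σ, z σ * coeff (m' σ) (monomial (m τ) 1 * g (Pi.single σ 1) τ)
  map_add' x y := by ext τ; simp [add_mul, Finset.sum_add_distrib]
  map_smul' a x := by ext τ; simp [mul_assoc, Finset.mul_sum]

variable {m' : Fin r' → Mon n} {m : Fin r → Mon n}
  {g : (Fin r' → MvPolynomial (Fin n) k) →ₗ[MvPolynomial (Fin n) k]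
      (Fin r → MvPolynomial (Fin n) k)}

theorem eq_sum_smul_single {R : Type*} [CommSemiring R] (p : Fin r → R) :
    p = ∑ σ, p σ • Pi.single σ (1 : R) := by
  ext σ
  simp [Finset.sum_apply, Pi.single_apply]

theorem scalarMap_apply (z : Fin r' → k) (τ : Fin r) : scalarMap m' m g z τ =
    ∑ σ, z σ * coeff (m' σ) (monomial (m τ) 1 * g (Pi.single σ 1) τ) := rfl

theorem scalarMap_single (σ : Fin r') (τ : Fin r) : scalarMap m' m g (Pi.single σ 1) τ =
    coeff (m' σ) (monomial (m τ) 1 * g (Pi.single σ 1) τ) := by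
  rw [scalarMap_apply, Finset.sum_eq_single σ]
  · simp
  · intro b _ hb
    simp [hb]
  · simp

/-- Each matrix entry is a scalar times a monomial. Multiplying by the target multidegree records
this without subtracting exponents. -/
theorem monomial_mul_map_single (hg : IsHomogeneousMap m' m g) (σ : Fin r') (τ : Fin r) :
    monomial (m τ) 1 * g (Pi.single σ 1) τ =
      monomial (m' σ) (scalarMap m' m g (Pi.single σ 1) τ) := by
  rw [scalarMap_single]
  ext e
  rw [coeff_monomial]
  split_ifs with h
  · rw [h]
  · rw [coeff_monomial_mul']
    split_ifs with hle
    · rw [one_mul, ← notMem_support_iff]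
      intro he
      exact h (by rw [← hg σ τ _ he, tsub_add_cancel_of_le hle])
    · rfl

theorem component_map (hg : IsHomogeneousMap m' m g) (c : Mon n)
    (p : Fin r' → MvPolynomial (Fin n) k) :
    component m c (g p) = scalarMap m' m g (component m' c p) := by
  ext τ
  conv_lhs => rw [eq_sum_smul_single p]
  rw [component_apply, map_sum, Finset.sum_apply, Finset.mul_sum, coeff_sum, scalarMap_apply]
  refine Finset.sum_congr rfl fun σ _ => ?_
  rw [map_smul, Pi.smul_apply, smul_eq_mul, mul_left_comm, monomial_mul_map_single hg,
    component_apply, coeff_monomial (m' σ), if_pos rfl, coeff_mul_monomial', coeff_monomial_mul',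
    one_mul]
  split_ifs <;> simp

theorem le_of_scalarMap_ne_zero (σ : Fin r') (τ : Fin r)
    (h : scalarMap m' m g (Pi.single σ 1) τ ≠ 0) : m τ ≤ m' σ := by
  rw [scalarMap_single, coeff_monomial_mul'] at h
  by_contra h'
  exact h (if_neg h')

theorem map_homogeneousElement (hg : IsHomogeneousMap m' m g) {c : Mon n} {z : Fin r' → k}
    (hz : ∀ σ, z σ ≠ 0 → m' σ ≤ c) :
    g (homogeneousElement m' c z) = homogeneousElement m c (scalarMap m' m g z) := by
  refine ext_component (m := m) fun c' => ?_
  rw [component_map hg]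
  by_cases h : c = c'
  · subst h
    rw [component_homogeneousElement_self hz, component_homogeneousElement_self]
    intro τ hτ
    rw [scalarMap_apply] at hτ
    obtain ⟨σ, -, hσ⟩ := Finset.exists_ne_zero_of_sum_ne_zero hτ
    rw [← scalarMap_single] at hσ
    exact (le_of_scalarMap_ne_zero σ τ (right_ne_zero_of_mul hσ)).trans
      (hz σ (left_ne_zero_of_mul hσ))
  · rw [component_homogeneousElement_of_ne h, component_homogeneousElement_of_ne h, map_zero]

theorem homogeneousElement_component_single (m : Fin r → Mon n) (σ : Fin r) :
    homogeneousElement m (m σ) (Pi.single σ (1 : k)) = Pi.single σ 1 := by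
  ext1 τ
  by_cases h : τ = σ
  · subst h
    rw [homogeneousElement, if_pos le_rfl, tsub_self, Pi.single_eq_same, Pi.single_eq_same]
    rfl
  · simp [homogeneousElement, h]

/-- The exponents of the monomials in an ideal. -/
def exponents (M : Ideal (MvPolynomial (Fin n) k)) : Set (Mon n) := {a | monomial a (1 : k) ∈ M}

theorem isUpperSet_exponents (M : Ideal (MvPolynomial (Fin n) k)) : IsUpperSet (exponents M) := by
  intro a b hab ha
  have : monomial b (1 : k) = monomial (b - a) 1 * monomial a 1 := by
    rw [monomial_mul, tsub_add_cancel_of_le hab, one_mul]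
  change monomial b (1 : k) ∈ M
  rw [this]
  exact M.mul_mem_left _ ha

theorem monomial_mem_of_mem_exponents {M : Ideal (MvPolynomial (Fin n) k)} {a : Mon n}
    (h : a ∈ exponents M) (x : k) : monomial a x ∈ M := by
  have : monomial a x = C x * monomial a 1 := by rw [C_mul_monomial, mul_one]
  rw [this]
  exact M.mul_mem_left _ h

theorem coeff_eq_zero_of_mem {M : Ideal (MvPolynomial (Fin n) k)} (hM : IsMonomialIdeal M)
    {p : MvPolynomial (Fin n) k} (hp : p ∈ M) {a : Mon n} (ha : a ∉ exponents M) :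
    coeff a p = 0 := by
  obtain ⟨A, rfl⟩ := hM
  by_contra h
  obtain ⟨b, hb, hba⟩ := mem_ideal_span_monomial_image.1 hp a (mem_support_iff.2 h)
  exact ha (isUpperSet_exponents _ hba (Ideal.subset_span ⟨b, hb, rfl⟩))

theorem isUnit_iff_of_support {p : MvPolynomial (Fin n) k} {a b : Mon n}
    (h : ∀ e ∈ p.support, e + a = b) : IsUnit p ↔ a = b ∧ p ≠ 0 := by
  constructor
  · intro hp
    have hp0 := hp.ne_zero
    obtain ⟨-, hu⟩ := MvPolynomial.isUnit_iff_eq_C_of_isReduced.1 hp |>.choose_spec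
    refine ⟨?_, hp0⟩
    rw [hu] at h hp0
    have := h 0 (by
      rw [mem_support_iff, coeff_zero_C]
      rintro h0
      exact hp0 (by rw [h0, map_zero]))
    rwa [zero_add] at this
  · rintro ⟨rfl, hp⟩
    have hs : ∀ e ∈ p.support, e = 0 := fun e he => by simpa using h e he
    have : p = C (coeff 0 p) := by
      ext e
      rw [coeff_C]
      split_ifs with he
      · rw [he]
      · rw [← notMem_support_iff]
        exact fun h' => he (hs e h').symm
    rw [this] at hp ⊢
    refine IsUnit.map C (isUnit_iff_ne_zero.2 ?_)
    rintro h0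
    exact hp (by rw [h0, map_zero])

end Components

/-! ### The strands of a resolution: base case of the induction. -/

namespace FreeResolution

variable {n : ℕ} {k : Type*} [Field k] {M : Ideal (MvPolynomial (Fin n) k)} (F : FreeResolution M)

theorem isHomogeneousMap_d (i : ℕ) : IsHomogeneousMap (F.mdeg (i + 1)) (F.mdeg i) (F.d i) :=
  F.d_homogeneous i

/-- The complex of scalars of a multigraded free resolution. -/
noncomputable abbrev toBasedComplex : BasedComplex n k where
  rank := F.rank
  mdeg := F.mdeg
  d i := scalarMap (F.mdeg (i + 1)) (F.mdeg i) (F.d i)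
  d_le i σ τ h := le_of_scalarMap_ne_zero σ τ h
  d_d i z := by
    have hz := eq_sum_smul_single z
    rw [hz]
    simp only [map_sum, map_smul]
    refine Finset.sum_eq_zero fun σ _ => ?_
    have h1 : (Pi.single σ 1 : Fin (F.rank (i + 1 + 1)) → k) =
        component (F.mdeg (i + 1 + 1)) (F.mdeg _ σ) (Pi.single σ 1) := by
      rw [← homogeneousElement_component_single (F.mdeg (i + 1 + 1)) σ,
        component_homogeneousElement_self]
      intro τ hτ
      have : τ = σ := by
        by_contra hne
        exact hτ (Pi.single_eq_of_ne hne _)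
      rw [this]
    rw [h1, ← component_map (F.isHomogeneousMap_d _), ← component_map (F.isHomogeneousMap_d _),
      (F.exact_succ i).apply_apply_eq_zero, map_zero, smul_zero]

/-- The scalars of the augmentation. -/
noncomputable def augScalar (σ : Fin (F.rank 0)) : k := (F.aug_homogeneous σ).choose

theorem aug_single (σ : Fin (F.rank 0)) : F.aug (Pi.single σ 1) =
    Ideal.Quotient.mk M (monomial (F.mdeg 0 σ) (F.augScalar σ)) :=
  (F.aug_homogeneous σ).choose_spec

theorem aug_apply (p) : F.aug p =
    Ideal.Quotient.mk M (∑ σ, p σ * monomial (F.mdeg 0 σ) (F.augScalar σ)) := by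
  conv_lhs => rw [eq_sum_smul_single p]
  rw [map_sum, map_sum]
  refine Finset.sum_congr rfl fun σ _ => ?_
  rw [map_smul, aug_single, map_mul]
  rfl

theorem aug_homogeneousElement {c : Mon n} {z : Fin (F.rank 0) → k}
    (hz : ∀ σ, z σ ≠ 0 → F.mdeg 0 σ ≤ c) : F.aug (homogeneousElement (F.mdeg 0) c z) =
      Ideal.Quotient.mk M (monomial c (∑ σ, z σ * F.augScalar σ)) := by
  rw [aug_apply, map_sum (monomial c)]
  congr 1
  refine Finset.sum_congr rfl fun σ _ => ?_
  by_cases h : z σ = 0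
  · simp [homogeneousElement, h]
  · rw [homogeneousElement, if_pos (hz σ h), monomial_mul, tsub_add_cancel_of_le (hz σ h)]

theorem isCycle_zero_iff {P : Set (Mon n)} {z : Fin (F.rank 0) → k} :
    F.toBasedComplex.IsCycle P 0 z ↔ ∀ σ, z σ ≠ 0 → F.mdeg 0 σ ∈ P :=
  BasedComplex.proj_eq_self_iff (K := F.toBasedComplex)

theorem dOn_flag_zero_eq_d {c : Mon n} {i : ℕ} {z : Fin (F.rank (i + 1)) → k}
    (hz : ∀ σ, z σ ≠ 0 → F.mdeg (i + 1) σ ≤ c) :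
    F.toBasedComplex.dOn (flag 0 c) i z = F.toBasedComplex.d i z := by
  have hp : F.toBasedComplex.proj (flag 0 c) (i + 1) z = z :=
    BasedComplex.proj_eq_self_iff.2 fun σ hσ => by rw [flag_zero]; exact hz σ hσ
  rw [BasedComplex.dOn, LinearMap.comp_apply, LinearMap.comp_apply, hp,
    BasedComplex.proj_eq_self_iff]
  intro τ hτ
  obtain ⟨σ, hσ, hle⟩ := BasedComplex.exists_le_of_d_ne_zero hτ
  rw [flag_zero]
  exact hle.trans (hz σ hσ)

/-- Elements in the kernel come from boundaries in each multidegree. -/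
theorem isBoundary_component {c : Mon n} {i : ℕ} {z : Fin (F.rank i) → k}
    {p : Fin (F.rank (i + 1)) → MvPolynomial (Fin n) k}
    (hz : ∀ σ, z σ ≠ 0 → F.mdeg i σ ≤ c)
    (hp : F.d i p = homogeneousElement (F.mdeg i) c z) :
    F.toBasedComplex.IsBoundary (flag 0 c) i z := by
  refine ⟨component (F.mdeg (i + 1)) c p, ?_⟩
  rw [dOn_flag_zero_eq_d]
  · have := component_map (F.isHomogeneousMap_d i) c p
    rw [hp, component_homogeneousElement_self hz] at this
    exact this
  · intro σ hσ
    by_contra h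
    exact hσ (component_apply_of_not_le h p)

theorem isBoundary_zero_of_sum {c : Mon n} {z : Fin (F.rank 0) → k}
    (hz : ∀ σ, z σ ≠ 0 → F.mdeg 0 σ ≤ c)
    (h : monomial c (∑ σ, z σ * F.augScalar σ) ∈ M) :
    F.toBasedComplex.IsBoundary (flag 0 c) 0 z := by
  have h0 : F.aug (homogeneousElement (F.mdeg 0) c z) = 0 := by
    rw [aug_homogeneousElement F hz]
    exact Ideal.Quotient.eq_zero_iff_mem.2 h
  obtain ⟨p, hp⟩ := (F.exact_zero _).1 h0
  exact F.isBoundary_component hz hp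

theorem sum_eq_zero_of_isBoundary {c : Mon n} (hc : c ∉ exponents M) {z : Fin (F.rank 0) → k}
    (h : F.toBasedComplex.IsBoundary (flag 0 c) 0 z) : ∑ σ, z σ * F.augScalar σ = 0 := by
  obtain ⟨w, hw⟩ := h
  set v : Fin (F.rank 1) → k := F.toBasedComplex.proj (flag 0 c) 1 w with hv
  have hvs : ∀ σ, v σ ≠ 0 → F.mdeg 1 σ ≤ c := by
    have := BasedComplex.proj_eq_self_iff.1
      (BasedComplex.proj_proj_of_subset (K := F.toBasedComplex) (subset_refl (flag 0 c)) (i := 1) w)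
    rw [flag_zero] at this
    intro σ hσ
    rw [hv, flag_zero] at hσ
    exact this σ hσ
  rw [← BasedComplex.dOn_proj] at hw
  have hz : ∀ σ, z σ ≠ 0 → F.mdeg 0 σ ≤ c := by
    have := BasedComplex.proj_eq_self_iff.1
      (BasedComplex.proj_dOn (K := F.toBasedComplex) (flag 0 c) 0 (F.toBasedComplex.proj (flag 0 c) 1 w))
    rw [← hw, flag_zero] at this
    exact this
  have hzv : z = scalarMap (F.mdeg 1) (F.mdeg 0) (F.d 0) v := by
    rw [hw]
    exact F.dOn_flag_zero_eq_d hvs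
  have h1 := map_homogeneousElement (F.isHomogeneousMap_d 0) hvs
  rw [← hzv] at h1
  have h2 := F.aug_homogeneousElement hz
  rw [← h1, F.exact_zero.apply_apply_eq_zero] at h2
  by_contra hne
  refine hc ?_
  -- A nonzero augmentation scalar could be inverted, putting the monomial `c` itself into `M`.
  have h3 := M.mul_mem_left (C (∑ σ, z σ * F.augScalar σ)⁻¹) (Ideal.Quotient.eq_zero_iff_mem.1 h2.symm)
  rwa [C_mul_monomial, inv_mul_cancel₀ hne] at h3

theorem isPartialSocle_zero_iff {I : Set (Mon n)} {c : Mon n} : IsPartialSocle I 0 c ↔ c ∉ I := by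
  have : firstVars n 0 = 0 := by ext j; simp [firstVars_apply]
  simp [IsPartialSocle, this]

/-- The degree `c` strand of `F` resolves the degree `c` part of S/M, which is `k` or zero. A degree
zero chain outside `M` is classified by its augmentation scalar, and multiplication by monomials
preserves that scalar. -/
theorem resolvesUpTo_zero (hM : IsMonomialIdeal M) :
    F.toBasedComplex.ResolvesUpTo (exponents M) 0 := by
  have hsupp : ∀ {c : Mon n} {i} {z : Fin (F.rank i) → k},
      F.toBasedComplex.IsCycle (flag 0 c) i z → ∀ σ, z σ ≠ 0 → F.mdeg i σ ≤ c := by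
    intro c i z hz
    have := BasedComplex.proj_eq_self_iff.1 hz.proj_eq
    rwa [flag_zero] at this
  refine ⟨?_, ?_, ?_, ?_⟩
  · intro c i z hi hz
    obtain ⟨i, rfl⟩ : ∃ i', i = i' + 1 := ⟨i - 1, by omega⟩
    have h0 := hz.2
    rw [F.dOn_flag_zero_eq_d (hsupp hz)] at h0
    have h1 := map_homogeneousElement (F.isHomogeneousMap_d i) (hsupp hz)
    have h0' : scalarMap (F.mdeg (i + 1)) (F.mdeg i) (F.d i) z = 0 := h0
    rw [h0'] at h1
    have h2 : homogeneousElement (F.mdeg i) c (0 : Fin (F.rank i) → k) = 0 := by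
      ext1 σ
      simp [homogeneousElement]
    rw [h2] at h1
    obtain ⟨p, hp⟩ := (F.exact_succ i _).1 h1
    exact F.isBoundary_component (hsupp hz) hp
  · intro c z hc hz
    rw [isPartialSocle_zero_iff, not_not] at hc
    exact F.isBoundary_zero_of_sum (hsupp hz) (monomial_mem_of_mem_exponents hc _)
  · intro c hc
    rw [isPartialSocle_zero_iff] at hc
    obtain ⟨p, hp⟩ := F.aug_surjective (Ideal.Quotient.mk M (monomial c 1))
    set y := component (F.mdeg 0) c p with hy
    have hys : ∀ σ, y σ ≠ 0 → F.mdeg 0 σ ≤ c := by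
      intro σ hσ
      by_contra h
      exact hσ (component_apply_of_not_le h p)
    have hy1 : ∑ σ, y σ * F.augScalar σ = 1 := by
      rw [aug_apply, Ideal.Quotient.mk_eq_mk_iff_sub_mem] at hp
      have h := coeff_eq_zero_of_mem hM hp hc
      rw [coeff_sub, coeff_monomial, if_pos rfl, sub_eq_zero, coeff_sum] at h
      rw [← h]
      refine Finset.sum_congr rfl fun σ _ => ?_
      rw [hy, component_apply, coeff_mul_monomial', coeff_monomial_mul']
      split_ifs <;> simp
    refine ⟨y, F.isCycle_zero_iff.2 fun σ hσ => ?_, fun hb => ?_, fun z hz =>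
      ⟨∑ σ, z σ * F.augScalar σ, F.isBoundary_zero_of_sum (fun σ hσ => ?_) ?_⟩⟩
    · rw [flag_zero]; exact hys σ hσ
    · rw [F.sum_eq_zero_of_isBoundary hc hb] at hy1
      exact zero_ne_one hy1
    · by_cases h : z σ = 0
      · refine hys σ fun h' => hσ ?_
        rw [Pi.sub_apply, Pi.smul_apply, h, h', smul_zero, sub_zero]
      · exact hsupp hz σ h
    · have : ∑ σ, (z - (∑ σ, z σ * F.augScalar σ) • y) σ * F.augScalar σ = 0 := by
        simp only [Pi.sub_apply, Pi.smul_apply, smul_eq_mul, sub_mul, mul_assoc]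
        rw [Finset.sum_sub_distrib, ← Finset.mul_sum, hy1, mul_one, sub_self]
      rw [this, map_zero]
      exact M.zero_mem
  · intro c c' _ _ hc hc' z hz hb
    rw [isPartialSocle_zero_iff] at hc hc'
    refine F.isBoundary_zero_of_sum (hsupp hz) ?_
    rw [F.sum_eq_zero_of_isBoundary hc' hb, map_zero]
    exact M.zero_mem

theorem mdeg_injective_and_range (hM : IsMonomialIdeal M) (hF : F.IsMinimal) :
    Function.Injective (F.mdeg n) ∧
      Set.range (F.mdeg n) = {c | IsPartialSocle (exponents M) n c} := by
  refine ((F.resolvesUpTo_zero hM).of_zero (isUpperSet_exponents M)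
    le_rfl).mdeg_injective_and_range fun i σ τ h => ?_
  have hu := hF i σ τ
  rw [isUnit_iff_of_support (F.d_homogeneous i σ τ)] at hu
  have h0 : F.d i (Pi.single σ 1) τ = 0 := by
    by_contra h'
    exact hu ⟨h, h'⟩
  change scalarMap _ _ _ (Pi.single σ 1) τ = 0
  rw [scalarMap_single, h0, mul_zero, coeff_zero]

end FreeResolution

/-! ### Socle monomials and dominant sets. -/

section Dominant

variable {n : ℕ} {k : Type*} [Field k] {M : Ideal (MvPolynomial (Fin n) k)}

theorem firstVars_self (j : Fin n) : firstVars n n j = 1 := by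
  simp [firstVars_apply]

theorem exists_minGens_le {a : Mon n} (h : a ∈ exponents M) : ∃ g ∈ minGens M, g ≤ a := by
  obtain ⟨b, hba, hb⟩ :=
    exists_minimal_le_of_wellFoundedLT (fun a => monomial a (1 : k) ∈ M) a h
  exact ⟨b, hb, hba⟩

theorem stronglyDivides_iff_le {g c : Mon n} (hc : ∀ j, 1 ≤ c j) :
    StronglyDivides g c ↔ g ≤ c - firstVars n n := by
  refine forall_congr' fun j => ?_
  have := hc j
  rw [Finsupp.tsub_apply, firstVars_self]
  omega

/-- The lcms of the dominant sets in `𝒟_M` are the monomials `c` such that `c / (x_1 ⋯ x_n)` is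
in the socle of `S/M`. -/
theorem dominantLcms_eq : dominantLcms M = {c | IsPartialSocle (exponents M) n c} := by
  ext c
  constructor
  · rintro ⟨D, ⟨hDG, hD, hcard, hsd⟩, rfl⟩
    -- Without variables every monomial strongly divides vacuously, so `M` has no generators.
    -- Otherwise `Fin n` is nonempty, as `choose!` requires.
    rcases isEmpty_or_nonempty (Fin n) with _ | _
    · refine ⟨fun j => isEmptyElim j, fun hI => ?_, fun j => isEmptyElim j⟩
      obtain ⟨g, hg, -⟩ := exists_minGens_le hI
      exact hsd g hg fun j => isEmptyElim j
    choose! x hx using hD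
    have hinj : Set.InjOn x D := by
      intro m hm m' hm' h
      by_contra hne
      have h1 := hx m hm m' hm' (Ne.symm hne)
      have h2 := hx m' hm' m hm hne
      rw [h] at h1
      exact lt_asymm h1 h2
    -- `D` has as many elements as there are variables, so the dominating variables give a
    -- bijection.
    have hsurj : ∀ j, ∃ m ∈ D, x m = j := by
      have himg : D.image x = Finset.univ := by
        rw [← Finset.card_eq_iff_eq_univ, Finset.card_image_of_injOn hinj, hcard, Fintype.card_fin]
      intro j
      have := himg.symm ▸ Finset.mem_univ j
      simpa using this
    have hle : ∀ m ∈ D, m ≤ lcm D := fun m hm => Finset.le_sup (f := id) hm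
    have hlcm : ∀ m ∈ D, lcm D (x m) = m (x m) := by
      intro m hm
      refine le_antisymm ?_ (hle m hm _)
      have : ∀ E : Finset (Mon n), E ⊆ D → lcm E (x m) ≤ m (x m) := by
        intro E
        induction E using Finset.induction_on with
        | empty => exact fun _ => Nat.zero_le _
        | insert a E _ ih =>
          intro hE
          have h1 := ih ((Finset.subset_insert _ _).trans hE)
          rw [lcm, Finset.sup_insert, Finsupp.sup_apply]
          refine sup_le ?_ h1
          by_cases ha : a = m
          · rw [ha]; rfl
          · exact (hx m hm a (hE (Finset.mem_insert_self _ _)) ha).le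
      exact this D subset_rfl
    have hpos : ∀ j, 1 ≤ lcm D j := by
      intro j
      by_contra h0
      obtain ⟨m, hm, rfl⟩ := hsurj j
      rw [hlcm m hm] at h0
      -- If the exponent of `lcm D` vanished at its variable, `m` would strongly divide `lcm D`,
      -- being strictly smaller at every other variable.
      refine hsd m (hDG hm) fun i hi => ?_
      obtain ⟨m', hm', rfl⟩ := hsurj i
      by_cases hmm : m' = m
      · rw [hmm] at hi; omega
      · have := hx m hm m' hm' hmm
        omega
    refine ⟨fun j => by rw [firstVars_self]; exact hpos j, fun hI => ?_, fun j _ => ?_⟩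
    · obtain ⟨g, hg, hle'⟩ := exists_minGens_le hI
      exact hsd g hg ((stronglyDivides_iff_le hpos).2 hle')
    · obtain ⟨m, hm, rfl⟩ := hsurj j
      refine isUpperSet_exponents M (fun i => ?_) (hDG hm).1
      rw [Finsupp.add_apply, Finsupp.tsub_apply, firstVars_self, Finsupp.single_apply]
      have h1 := hpos i
      split_ifs with hi
      · have := hle m hm i
        omega
      · obtain ⟨m', hm', rfl⟩ := hsurj i
        have hmm : m ≠ m' := fun h => hi (by rw [h])
        have h2 := hx m' hm' m hm hmm
        rw [hlcm m' hm']
        omega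
  · rintro ⟨hc, hcI, hcj⟩
    have hpos : ∀ j, 1 ≤ c j := fun j => by
      have := hc j
      rwa [firstVars_self] at this
    have hg : ∀ j, ∃ g ∈ minGens M, g ≤ c - firstVars n n + Finsupp.single j 1 := fun j =>
      exists_minGens_le (hcj j j.2)
    choose g hgG hgle using hg
    have hgi : ∀ j i, i ≠ j → g j i < c i := by
      intro j i hij
      have h1 := hgle j i
      have h2 := hpos i
      rw [Finsupp.add_apply, Finsupp.tsub_apply, firstVars_self, Finsupp.single_apply,
        if_neg (Ne.symm hij)] at h1
      omega
    -- If the exponent were smaller, `g j` would divide c/(x_1⋯x_n), which lies outside `M`.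
    have hgj : ∀ j, g j j = c j := by
      intro j
      have h2 := hpos j
      refine le_antisymm ?_ ?_
      · have h1 := hgle j j
        rw [Finsupp.add_apply, Finsupp.tsub_apply, firstVars_self, Finsupp.single_apply,
          if_pos rfl] at h1
        omega
      · by_contra hlt
        refine hcI (isUpperSet_exponents M (fun i => ?_) (hgG j).1)
        rw [Finsupp.tsub_apply, firstVars_self]
        by_cases hij : i = j
        · rw [hij]; omega
        · have := hgi j i hij
          omega
    have hinj : Function.Injective g := by
      intro i j hij
      by_contra hne
      have := hgi j i hne
      rw [← hij, hgj] at this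
      exact lt_irrefl _ this
    have hlcm : c = lcm (Finset.univ.image g) := by
      refine le_antisymm (fun j => ?_) (Finset.sup_le fun m hm => ?_)
      · rw [← hgj j]
        exact Finset.le_sup (f := id) (Finset.mem_image_of_mem g (Finset.mem_univ j)) j
      · obtain ⟨j, -, rfl⟩ := Finset.mem_image.1 hm
        intro i
        by_cases hij : i = j
        · rw [hij]; exact (hgj j).le
        · exact (hgi j i hij).le
    refine ⟨Finset.univ.image g, ⟨?_, ?_, ?_, ?_⟩, hlcm⟩
    · intro m hm
      obtain ⟨j, -, rfl⟩ := Finset.mem_image.1 (Finset.mem_coe.1 hm)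
      exact hgG j
    · intro m hm
      obtain ⟨j, -, rfl⟩ := Finset.mem_image.1 (Finset.mem_coe.1 hm)
      refine ⟨j, fun m' hm' hne => ?_⟩
      obtain ⟨i, -, rfl⟩ := Finset.mem_image.1 (Finset.mem_coe.1 hm')
      rw [hgj j]
      exact hgi i j fun h => hne (by rw [h])
    · rw [Finset.card_image_of_injective _ hinj, Finset.card_univ, Fintype.card_fin]
    · intro m hm hsd
      rw [← hlcm, stronglyDivides_iff_le hpos] at hsd
      exact hcI (isUpperSet_exponents M hsd hm.1)

theorem FreeResolution.totalBetti_eq (hM : IsMonomialIdeal M) (F : FreeResolution M)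
    (hF : F.IsMinimal) : (F.totalBetti n : ℕ∞) = (dominantLcms M).encard := by
  obtain ⟨hinj, hrange⟩ := F.mdeg_injective_and_range hM hF
  rw [dominantLcms_eq, ← hrange, ← Set.image_univ, hinj.encard_image, Set.encard_univ,
    ENat.card_eq_coe_fintype_card, Fintype.card_fin]
  rfl

theorem FreeResolution.gradedBetti_eq (hM : IsMonomialIdeal M) (F : FreeResolution M)
    (hF : F.IsMinimal) (j : ℕ) : (F.gradedBetti n j : ℕ∞) =
      {l ∈ dominantLcms M | l.degree = j}.encard := by
  obtain ⟨hinj, hrange⟩ := F.mdeg_injective_and_range hM hF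
  have : {l ∈ dominantLcms M | l.degree = j} =
      F.mdeg n '' {σ | (F.mdeg n σ).degree = j} := by
    rw [dominantLcms_eq, ← hrange]
    ext l
    constructor
    · rintro ⟨⟨σ, rfl⟩, h⟩
      exact ⟨σ, h, rfl⟩
    · rintro ⟨σ, h, rfl⟩
      exact ⟨⟨σ, rfl⟩, h⟩
  rw [this, hinj.encard_image, Set.encard, ENat.card_eq_coe_fintype_card]
  rfl

end Dominant

end MonomialBetti
-- Existence of minimal resolutions.
namespace MonomialBetti

section Existence

variable {n : ℕ} {k : Type*} [Field k]

/-- A submodule of a free module that contains the homogeneous components of its elements. -/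
def IsHomogeneousSubmodule {r : ℕ} (m : Fin r → Mon n)
    (Z : Submodule (MvPolynomial (Fin n) k) (Fin r → MvPolynomial (Fin n) k)) : Prop :=
  ∀ p ∈ Z, ∀ c, homogeneousElement m c (component m c p) ∈ Z

theorem isHomogeneousSubmodule_ker {r r' : ℕ} {m' : Fin r' → Mon n} {m : Fin r → Mon n}
    {g : (Fin r' → MvPolynomial (Fin n) k) →ₗ[MvPolynomial (Fin n) k]
      (Fin r → MvPolynomial (Fin n) k)} (hg : IsHomogeneousMap m' m g) :
    IsHomogeneousSubmodule m' (LinearMap.ker g) := by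
  intro p hp c
  rw [LinearMap.mem_ker] at hp ⊢
  rw [map_homogeneousElement hg, ← component_map hg, hp, map_zero]
  · ext1 σ
    simp [homogeneousElement]
  · intro σ hσ
    by_contra h
    exact hσ (component_apply_of_not_le h p)

/-- A homogeneous submodule of a free module is generated by finitely many homogeneous elements. -/
theorem exists_homogeneous_generators {r : ℕ} {m : Fin r → Mon n}
    {Z : Submodule (MvPolynomial (Fin n) k) (Fin r → MvPolynomial (Fin n) k)}
    (hZ : IsHomogeneousSubmodule m Z) : ∃ (r' : ℕ) (m' : Fin r' → Mon n)
      (v : Fin r' → (Fin r → MvPolynomial (Fin n) k)),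
      (∀ σ τ, ∀ e ∈ (v σ τ).support, e + m τ = m' σ) ∧
        Submodule.span (MvPolynomial (Fin n) k) (Set.range v) = Z := by
  set H : Set (Fin r → MvPolynomial (Fin n) k) :=
    {p | p ∈ Z ∧ ∃ c, ∀ τ, ∀ e ∈ (p τ).support, e + m τ = c} with hH
  have hspan : Submodule.span _ H = Z := by
    refine le_antisymm (Submodule.span_le.2 fun p hp => hp.1) fun p hp => ?_
    obtain ⟨T, hT⟩ := exists_sum_homogeneousElement m p
    rw [hT]
    refine Submodule.sum_mem _ fun c _ => Submodule.subset_span ⟨hZ p hp c, c, fun τ e he => ?_⟩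
    rw [mem_support_iff, homogeneousElement, coeff_monomial] at he
    have h1 : c - m τ = e := by
      by_contra h
      exact he (if_neg h)
    have h2 : m τ ≤ c := by
      by_contra h
      simp [h] at he
    rw [← h1, tsub_add_cancel_of_le h2]
  have hfg : (Submodule.span (MvPolynomial (Fin n) k) H).FG := IsNoetherian.noetherian _
  obtain ⟨T, hTH, hT⟩ := (Submodule.fg_span_iff_fg_span_finset_subset H).1 hfg
  have hdeg : ∀ p : T, ∃ c, ∀ τ, ∀ e ∈ (p.1 τ).support, e + m τ = c := fun p => (hTH p.2).2
  choose c hc using hdeg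
  refine ⟨T.card, fun σ => c (T.equivFin.symm σ), fun σ => (T.equivFin.symm σ).1,
    fun σ => hc _, ?_⟩
  have hr : Set.range (fun σ => (T.equivFin.symm σ).1) = T := by
    ext p
    constructor
    · rintro ⟨σ, rfl⟩
      exact (T.equivFin.symm σ).2
    · exact fun hp => ⟨T.equivFin ⟨p, hp⟩, by simp⟩
  rw [hr, ← hT, hspan]

/-- The syzygies of a minimal system of homogeneous generators have no invertible coefficients. -/
theorem exists_minimal_homogeneous_cover {r : ℕ} {m : Fin r → Mon n}
    {Z : Submodule (MvPolynomial (Fin n) k) (Fin r → MvPolynomial (Fin n) k)}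
    (hZ : IsHomogeneousSubmodule m Z) : ∃ (r' : ℕ) (m' : Fin r' → Mon n)
      (g : (Fin r' → MvPolynomial (Fin n) k) →ₗ[MvPolynomial (Fin n) k]
        (Fin r → MvPolynomial (Fin n) k)),
      IsHomogeneousMap m' m g ∧ LinearMap.range g = Z ∧
        ∀ p ∈ LinearMap.ker g, ∀ σ, ¬ IsUnit (p σ) := by
  classical
  have hex := exists_homogeneous_generators hZ
  -- Take the least possible number of homogeneous generators; a syzygy with a unit coefficient
  -- would make one of them redundant.
  obtain ⟨m', v, hv, hspan⟩ := Nat.find_spec hex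
  have hmin := fun {s} => Nat.find_min (m := s) hex
  generalize Nat.find hex = r' at m' v hv hspan hmin
  refine ⟨r', m', Fintype.linearCombination _ v, fun σ τ => ?_, ?_, fun p hp σ hu => ?_⟩
  · have : Fintype.linearCombination (MvPolynomial (Fin n) k) v (Pi.single σ 1) = v σ := by simp
    rw [this]
    exact hv σ τ
  · rw [Fintype.range_linearCombination, hspan]
  · obtain ⟨s, rfl⟩ : ∃ s, r' = s + 1 := ⟨r' - 1, by have := σ.2; omega⟩
    refine hmin (Nat.lt_succ_self s) ⟨fun τ => m' (σ.succAbove τ), fun τ => v (σ.succAbove τ),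
      fun τ => hv _, ?_⟩
    rw [← hspan]
    refine le_antisymm (Submodule.span_mono ?_) (Submodule.span_le.2 ?_)
    · rintro _ ⟨τ, rfl⟩
      exact ⟨_, rfl⟩
    · rintro _ ⟨ρ, rfl⟩
      rcases Fin.eq_self_or_eq_succAbove σ ρ with rfl | ⟨τ, rfl⟩
      · rw [LinearMap.mem_ker, Fintype.linearCombination_apply, Fin.sum_univ_succAbove _ ρ,
          add_eq_zero_iff_eq_neg] at hp
        have h1 : p ρ • v ρ ∈ Submodule.span (MvPolynomial (Fin n) k)
            (Set.range fun τ => v (ρ.succAbove τ)) := by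
          rw [hp]
          exact Submodule.neg_mem _ (Submodule.sum_mem _ fun τ _ =>
            Submodule.smul_mem _ _ (Submodule.subset_span ⟨τ, rfl⟩))
        obtain ⟨u, hu⟩ := hu
        have h2 := Submodule.smul_mem _ (↑u⁻¹ : MvPolynomial (Fin n) k) h1
        rwa [← hu, smul_smul, Units.inv_mul, one_smul] at h2
      · exact Submodule.subset_span ⟨τ, rfl⟩

/-- A free module with a homogeneous submodule whose elements have no invertible coefficients. -/
structure SyzygyModule (n : ℕ) (k : Type*) [Field k] where
  /-- the rank of the free module -/
  rank : ℕ
  /-- the multidegrees of the basis elements -/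
  mdeg : Fin rank → Mon n
  /-- the submodule -/
  module : Submodule (MvPolynomial (Fin n) k) (Fin rank → MvPolynomial (Fin n) k)
  homogeneous : IsHomogeneousSubmodule mdeg module
  not_isUnit : ∀ p ∈ module, ∀ σ, ¬ IsUnit (p σ)

namespace SyzygyModule

variable (Z : SyzygyModule n k)

/-- The rank of the minimal free cover. -/
noncomputable def coverRank : ℕ := (exists_minimal_homogeneous_cover Z.homogeneous).choose

/-- The multidegrees of the basis elements of the minimal free cover. -/
noncomputable def coverMdeg : Fin Z.coverRank → Mon n :=
  (exists_minimal_homogeneous_cover Z.homogeneous).choose_spec.choose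

/-- The minimal free cover. -/
noncomputable def cover : (Fin Z.coverRank → MvPolynomial (Fin n) k) →ₗ[MvPolynomial (Fin n) k]
    (Fin Z.rank → MvPolynomial (Fin n) k) :=
  (exists_minimal_homogeneous_cover Z.homogeneous).choose_spec.choose_spec.choose

theorem cover_spec : IsHomogeneousMap Z.coverMdeg Z.mdeg Z.cover ∧
    LinearMap.range Z.cover = Z.module ∧ ∀ p ∈ LinearMap.ker Z.cover, ∀ σ, ¬ IsUnit (p σ) :=
  (exists_minimal_homogeneous_cover Z.homogeneous).choose_spec.choose_spec.choose_spec

/-- The kernel of the minimal free cover. -/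
noncomputable def next : SyzygyModule n k where
  rank := Z.coverRank
  mdeg := Z.coverMdeg
  module := LinearMap.ker Z.cover
  homogeneous := isHomogeneousSubmodule_ker Z.cover_spec.1
  not_isUnit := Z.cover_spec.2.2

/-- The iterated syzygy modules. -/
noncomputable def iterate : ℕ → SyzygyModule n k
  | 0 => Z
  | i + 1 => (iterate i).next

/-- The minimal resolution of the quotient of a free module by a homogeneous submodule, if the
quotient is `S/M`. -/
noncomputable def resolution {M : Ideal (MvPolynomial (Fin n) k)}
    (aug : (Fin Z.rank → MvPolynomial (Fin n) k) →ₗ[MvPolynomial (Fin n) k]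
      (MvPolynomial (Fin n) k ⧸ M))
    (hsurj : Function.Surjective aug) (hker : LinearMap.ker aug = Z.module)
    (hhom : ∀ σ, ∃ c : k,
      aug (Pi.single σ 1) = Ideal.Quotient.mk M (monomial (Z.mdeg σ) c)) :
    FreeResolution M where
  rank i := (Z.iterate i).rank
  mdeg i := (Z.iterate i).mdeg
  d i := (Z.iterate i).cover
  aug := aug
  aug_surjective := hsurj
  exact_zero := fun p => (SetLike.ext_iff.1 (Z.cover_spec.2.1.trans hker.symm) p).symm
  exact_succ i := fun p => (SetLike.ext_iff.1 (Z.iterate i).next.cover_spec.2.1 p).symm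
  aug_homogeneous := hhom
  d_homogeneous i := (Z.iterate i).cover_spec.1

/-- The columns of each differential lie in a syzygy module, whose elements have no unit
coordinates. -/
theorem isMinimal_resolution {M : Ideal (MvPolynomial (Fin n) k)}
    (aug : (Fin Z.rank → MvPolynomial (Fin n) k) →ₗ[MvPolynomial (Fin n) k]
      (MvPolynomial (Fin n) k ⧸ M))
    (hsurj : Function.Surjective aug) (hker : LinearMap.ker aug = Z.module)
    (hhom : ∀ σ, ∃ c : k,
      aug (Pi.single σ 1) = Ideal.Quotient.mk M (monomial (Z.mdeg σ) c)) :
    (Z.resolution aug hsurj hker hhom).IsMinimal := by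
  intro i σ τ
  refine (Z.iterate i).not_isUnit _ ?_ τ
  rw [← (Z.iterate i).cover_spec.2.1]
  exact ⟨_, rfl⟩

end SyzygyModule

/-- The quotient by a monomial ideal has a minimal multigraded free resolution. -/
theorem exists_isMinimal {M : Ideal (MvPolynomial (Fin n) k)} (hM : IsMonomialIdeal M) :
    ∃ F : FreeResolution M, F.IsMinimal := by
  -- For the unit ideal a rank one start would have the unit 1 in its kernel, so the resolution
  -- starts with rank zero.
  by_cases htop : M = ⊤
  · subst htop
    let Z : SyzygyModule n k :=
      { rank := 0
        mdeg := fun _ => 0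
        module := ⊤
        homogeneous := fun _ _ _ => trivial
        not_isUnit := fun _ _ σ => σ.elim0 }
    exact ⟨_, Z.isMinimal_resolution 0 (fun x => ⟨0, (Submodule.Quotient.subsingleton_iff.2 rfl).elim _ _⟩)
      LinearMap.ker_zero fun σ => Fin.elim0 σ⟩
  · let aug : (Fin 1 → MvPolynomial (Fin n) k) →ₗ[MvPolynomial (Fin n) k]
        (MvPolynomial (Fin n) k ⧸ M) := M.mkQ ∘ₗ LinearMap.proj 0
    have haug : ∀ p, aug p = Ideal.Quotient.mk M (p 0) := fun _ => rfl
    have hker : ∀ p, p ∈ LinearMap.ker aug ↔ p 0 ∈ M := fun p => by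
      rw [LinearMap.mem_ker, haug, Ideal.Quotient.eq_zero_iff_mem]
    let Z : SyzygyModule n k :=
      { rank := 1
        mdeg := fun _ => 0
        module := LinearMap.ker aug
        homogeneous := fun p hp c => by
          rw [hker] at hp ⊢
          rw [homogeneousElement, component_apply, tsub_zero, if_pos zero_le]
          by_cases hc : c ∈ exponents M
          · exact monomial_mem_of_mem_exponents hc _
          · have h0 : monomial (0 : Mon n) (1 : k) * p 0 = p 0 := one_mul _
            rw [h0, coeff_eq_zero_of_mem hM hp hc, map_zero]
            exact M.zero_mem
        not_isUnit := fun p hp σ hu => by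
          rw [hker] at hp
          rw [Subsingleton.elim σ 0] at hu
          exact htop (M.eq_top_of_isUnit_mem hp hu) }
    refine ⟨_, Z.isMinimal_resolution aug (fun x => ?_) rfl fun σ => ⟨1, ?_⟩⟩
    · obtain ⟨p, rfl⟩ := Ideal.Quotient.mk_surjective x
      exact ⟨fun _ => p, rfl⟩
    · rw [Subsingleton.elim σ (0 : Fin 1)]
      change Ideal.Quotient.mk M ((Pi.single 0 1 : Fin 1 → MvPolynomial (Fin n) k) 0) = _
      rw [Pi.single_eq_same]
      rfl

end Existence

end MonomialBetti

theorem mainTheorem3 {k : Type*} [Field k] (n : ℕ) (M : Ideal (MvPolynomial (Fin n) k))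
    (hM : MonomialBetti.IsMonomialIdeal M) :
    (∃ F : MonomialBetti.FreeResolution M, F.IsMinimal) ∧
    ∀ F : MonomialBetti.FreeResolution M, F.IsMinimal →
      (F.totalBetti n : ℕ∞) = (MonomialBetti.dominantLcms M).encard ∧
      ∀ j : ℕ, (F.gradedBetti n j : ℕ∞) =
        {l ∈ MonomialBetti.dominantLcms M | l.degree = j}.encard :=
  ⟨MonomialBetti.exists_isMinimal hM, fun F hF =>
    ⟨F.totalBetti_eq hM hF, fun j => F.gradedBetti_eq hM hF j⟩⟩
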